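/- Work on the torus $\mathbb T=[0,2\pi]^3$ with periodic boundary conditions. For $s\in\mathbb R$ let $H^s$ be the space of real mean-zero Fourier series $f=\sum_{k\in\mathbb Z^3\setminus 0}f_k e^{ik\cdot x}$, $f_{-k}=\overline{f_k}$, with $\|f\|_{H^s}^2=\sum_k|f_k|^2|k|^{2s}<\infty$, and let $V^s$ be the space of $\mathbb R^3$-valued, divergence-free ($w_k\cdot k=0$) such series $w$ with $\|w\|_{V^s}^2=\sum_k|w_k|^2|k|^{2s}<\infty$. Write $\Lambda=(-\Delta)^{1/2}$, $\langle f,g\rangle=\sum_k f_k g_{-k}$ (and $\langle v,w\rangle=\sum_k v_k\cdot w_{-k}$), let $\Pi$ be the Leray–Helmholtz projection, and let $\langle B(u,v),w\rangle=\int_{\mathbb T}\big((u\cdot\nabla)v\big)\cdot w\,dx$ and $\langle u\cdot\nabla\phi,\theta\rangle=\int_{\mathbb T}(u\cdot\nabla\phi)\,\theta\,dx$, where $dx$ is normalised to total mass one. Let $\nu>0$ and $T>0$, and consider $$\partial_t v+B(u,v)+\nu\Lambda^{2\beta}v=\Pi(\theta e_3),\qquad \partial_t\theta+u\cdot\nabla\theta=0,\qquad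 v=\Lambda^{2\alpha}u .\tag{1}$$ A weak solution of (1) on $[0,T]$ with initial data $v_0\in V^0$, $\theta_0\in H^0$ is a couple $(v,\theta)$ with $v\in L^\infty(0,T;V^0)\cap L^2(0,T;V^\beta)\cap C_w([0,T];V^0)$ and $\theta\in L^\infty(0,T;H^0)\cap C_w([0,T];H^0)$ such that, for all $\psi\in V^{5/2}$, $\phi\in H^{5/2}$ and $t\in[0,T]$, with $u=\Lambda^{-2\alpha}v$, $$\langle v(t),\psi\rangle-\int_0^t\langle B(u(s),\psi),v(s)\rangle ds+\nu\int_0^t\langle\Lambda^\beta v(s),\Lambda^\beta\psi\rangle ds=\langle v_0,\psi\rangle+\int_0^t\langle\theta(s)e_3,\psi\rangle ds,$$ $$\langle\theta(t),\phi\rangle-\int_0^t\langle u(s)\cdot\nabla\phi,\theta(s)\rangle ds=\langle\theta_0,\phi\rangle .$$ **Theorem (Uniqueness).** Let $\tfrac12<\beta<\tfrac54$, $\alpha+\beta=\tfrac54$ and $r>\max(2\beta,\beta+1)$, and let $v_0\in V^r$, $\theta_0\in H^{r-\beta}$. If $(v_1,\theta_1)$ and $(v_2,\theta_2)$ are weak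 solutions of (1) on $[0,T]$ with the same initial data $(v_0,\theta_0)$ and both satisfy $$v_i\in C([0,T];V^r)\cap L^2(0,T;V^{r+\beta}),\qquad \theta_i\in C([0,T];H^{r-\beta}),$$ then $v_1(t)=v_2(t)$ and $\theta_1(t)=\theta_2(t)$ for every $t\in[0,T]$. -/

import Mathlib

namespace Boussinesq

open MeasureTheory Filter Topology Set
open scoped ENNReal ComplexConjugate

noncomputable section

/-! ### Fourier series on the torus `[0, 2π]³` -/

/-- Frequencies `k ∈ ℤ³`. -/
abbrev Freq : Type := Fin 3 → ℤ

/-- Formal scalar Fourier series `f = ∑ₖ fₖ e^{i k·x}`, given by their coefficients. -/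
abbrev ScalarSeries : Type := Freq → ℂ

/-- Formal vector Fourier series `w = ∑ₖ wₖ e^{i k·x}`, `wₖ ∈ ℂ³`, given by their coefficients. -/
abbrev VectorSeries : Type := Freq → EuclideanSpace ℂ (Fin 3)

/-- The Euclidean length `|k|` of a frequency. -/
def freqNorm (k : Freq) : ℝ := Real.sqrt (∑ i, (k i : ℝ) ^ 2)

/-- The operator `Λ^s = (-Δ)^{s/2}`: multiplication of the `k`-th coefficient by `|k|^s`.
It is only applied to series whose coefficient at `k = 0` vanishes. -/
def Lam {E : Type*} [AddCommGroup E] [Module ℝ E] (s : ℝ) (f : Freq → E) : Freq → E :=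
  fun k => (freqNorm k ^ s) • f k

/-! ### The Sobolev spaces `H^s` and `V^s` -/

/-- `∑ₖ |fₖ|² |k|^{2s} < ∞` says that `Λ^s f` has square summable coefficients. -/
theorem memlp_Lam_iff {E : Type*} [NormedAddCommGroup E] [NormedSpace ℝ E]
    (s : ℝ) (f : Freq → E) :
    Memℓp (Lam s f) 2 ↔ Summable fun k => ‖f k‖ ^ 2 * freqNorm k ^ (2 * s) := by
  rw [memℓp_gen_iff (by norm_num)]
  refine summable_congr fun k => ?_
  have h0 : 0 ≤ freqNorm k := Real.sqrt_nonneg _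
  have h1 : 0 ≤ freqNorm k ^ s := Real.rpow_nonneg h0 s
  rw [Lam, norm_smul, Real.norm_of_nonneg h1, ENNReal.toReal_ofNat, Real.rpow_two, mul_pow,
    mul_comm, mul_comm 2 s, Real.rpow_mul h0, Real.rpow_two]

theorem Lam_add {E : Type*} [AddCommGroup E] [Module ℝ E] (s : ℝ) (f g : Freq → E) :
    Lam s (f + g) = Lam s f + Lam s g := by
  funext k; simp [Lam]

theorem Lam_smul {E : Type*} [AddCommGroup E] [Module ℝ E] (s c : ℝ) (f : Freq → E) :
    Lam s (c • f) = c • Lam s f := by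
  funext k; exact smul_comm _ _ _

/-- Mean zero series with `∑ₖ |fₖ|² |k|^{2s} < ∞`, as a real vector space. -/
def weightedL2 (E : Type*) [NormedAddCommGroup E] [NormedSpace ℝ E] (s : ℝ) :
    Submodule ℝ (Freq → E) where
  carrier := {f | f 0 = 0 ∧ Summable fun k => ‖f k‖ ^ 2 * freqNorm k ^ (2 * s)}
  zero_mem' := by simp
  add_mem' := by
    rintro f g ⟨hf, hf'⟩ ⟨hg, hg'⟩
    refine ⟨by simp [hf, hg], ?_⟩
    rw [← memlp_Lam_iff] at hf' hg' ⊢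
    rw [Lam_add]
    exact hf'.add hg'
  smul_mem' := by
    rintro c f ⟨hf, hf'⟩
    refine ⟨by simp [hf], ?_⟩
    rw [← memlp_Lam_iff] at hf' ⊢
    rw [Lam_smul]
    exact hf'.const_smul c

/-- The real vector space underlying `H^s`: mean zero, `f₋ₖ = conj fₖ`,
`∑ₖ |fₖ|² |k|^{2s} < ∞`. -/
def HSub (s : ℝ) : Submodule ℝ ScalarSeries where
  carrier := {f | f ∈ weightedL2 ℂ s ∧ ∀ k, f (-k) = conj (f k)}
  zero_mem' := ⟨zero_mem _, by simp⟩
  add_mem' := by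
    rintro f g ⟨hf, hf'⟩ ⟨hg, hg'⟩
    exact ⟨add_mem hf hg, fun k => by simp [hf' k, hg' k]⟩
  smul_mem' := by
    rintro c f ⟨hf, hf'⟩
    exact ⟨Submodule.smul_mem _ c hf, fun k => by simp [hf' k]⟩

/-- The real vector space underlying `V^s`: mean zero, `w₋ₖ = conj wₖ`, `wₖ · k = 0`,
`∑ₖ |wₖ|² |k|^{2s} < ∞`. -/
def VSub (s : ℝ) : Submodule ℝ VectorSeries where
  carrier := {w | w ∈ weightedL2 (EuclideanSpace ℂ (Fin 3)) s ∧
    (∀ k i, w (-k) i = conj (w k i)) ∧ ∀ k, ∑ i, w k i * (k i : ℂ) = 0}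
  zero_mem' := ⟨zero_mem _, by simp, by simp⟩
  add_mem' := by
    rintro f g ⟨hf, hf', hf''⟩ ⟨hg, hg', hg''⟩
    refine ⟨add_mem hf hg, fun k i => by simp [hf' k, hg' k], fun k => ?_⟩
    simp [add_mul, Finset.sum_add_distrib, hf'' k, hg'' k]
  smul_mem' := by
    rintro c f ⟨hf, hf', hf''⟩
    refine ⟨Submodule.smul_mem _ c hf, fun k i => by simp [hf' k], fun k => ?_⟩
    simp [mul_assoc, ← Finset.mul_sum, hf'' k]

/-- The space `H^s`; its norm is defined below. -/
def HSpace (s : ℝ) : Type := HSub s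

/-- The space `V^s`; its norm is defined below. -/
def VSpace (s : ℝ) : Type := VSub s

instance (s : ℝ) : AddCommGroup (HSpace s) := inferInstanceAs (AddCommGroup (HSub s))
instance (s : ℝ) : Module ℝ (HSpace s) := inferInstanceAs (Module ℝ (HSub s))
instance (s : ℝ) : AddCommGroup (VSpace s) := inferInstanceAs (AddCommGroup (VSub s))
instance (s : ℝ) : Module ℝ (VSpace s) := inferInstanceAs (Module ℝ (VSub s))

/-- The Fourier coefficients of an element of `H^s`. -/
def HSpace.coeff {s : ℝ} (f : HSpace s) : ScalarSeries := f.1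

/-- The Fourier coefficients of an element of `V^s`. -/
def VSpace.coeff {s : ℝ} (w : VSpace s) : VectorSeries := w.1

/-- `Λ^s` as a map from `weightedL2 E s` to `ℓ²`. -/
def weightedL2.toL2 (E : Type*) [NormedAddCommGroup E] [NormedSpace ℝ E] (s : ℝ) :
    weightedL2 E s →ₗ[ℝ] lp (fun _ : Freq => E) 2 where
  toFun f := ⟨Lam s f.1, (memlp_Lam_iff s f.1).2 f.2.2⟩
  map_add' f g := Subtype.ext (Lam_add s f.1 g.1)
  map_smul' c f := Subtype.ext (Lam_smul s c f.1)

theorem freqNorm_pos {k : Freq} (hk : k ≠ 0) : 0 < freqNorm k := by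
  obtain ⟨i, hi⟩ := Function.ne_iff.1 hk
  refine Real.sqrt_pos.2 (Finset.sum_pos' (fun j _ => sq_nonneg _) ⟨i, Finset.mem_univ i, ?_⟩)
  have : (k i : ℝ) ≠ 0 := by exact_mod_cast hi
  positivity

theorem weightedL2.toL2_injective (E : Type*) [NormedAddCommGroup E] [NormedSpace ℝ E] (s : ℝ) :
    Function.Injective (weightedL2.toL2 E s) := by
  intro f g h
  refine Subtype.ext (funext fun k => ?_)
  by_cases hk : k = 0
  · rw [hk, f.2.1, g.2.1]
  · have h1 : Lam s f.1 k = Lam s g.1 k := congrFun (congrArg Subtype.val h) k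
    exact smul_right_injective E (Real.rpow_pos_of_pos (freqNorm_pos hk) s).ne' h1

theorem HSub_le (s : ℝ) : HSub s ≤ weightedL2 ℂ s := fun _ h => h.1

theorem VSub_le (s : ℝ) : VSub s ≤ weightedL2 (EuclideanSpace ℂ (Fin 3)) s := fun _ h => h.1

/-- The isometry `Λ^s : H^s → ℓ²`. -/
def HSpace.toL2 (s : ℝ) : HSpace s →ₗ[ℝ] lp (fun _ : Freq => ℂ) 2 :=
  show HSub s →ₗ[ℝ] lp (fun _ : Freq => ℂ) 2 from
    weightedL2.toL2 ℂ s ∘ₗ Submodule.inclusion (HSub_le s)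

/-- The isometry `Λ^s : V^s → ℓ²`. -/
def VSpace.toL2 (s : ℝ) : VSpace s →ₗ[ℝ] lp (fun _ : Freq => EuclideanSpace ℂ (Fin 3)) 2 :=
  show VSub s →ₗ[ℝ] lp (fun _ : Freq => EuclideanSpace ℂ (Fin 3)) 2 from
    weightedL2.toL2 (EuclideanSpace ℂ (Fin 3)) s ∘ₗ Submodule.inclusion (VSub_le s)

theorem HSpace.toL2_injective (s : ℝ) : Function.Injective (HSpace.toL2 s) :=
  (weightedL2.toL2_injective ℂ s).comp (Submodule.inclusion_injective (HSub_le s))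

theorem VSpace.toL2_injective (s : ℝ) : Function.Injective (VSpace.toL2 s) :=
  (weightedL2.toL2_injective (EuclideanSpace ℂ (Fin 3)) s).comp
    (Submodule.inclusion_injective (VSub_le s))

/-- The norm `‖f‖_{H^s} = (∑ₖ |fₖ|² |k|^{2s})^{1/2}`, i.e. the `ℓ²` norm of `Λ^s f`. -/
instance (s : ℝ) : NormedAddCommGroup (HSpace s) :=
  NormedAddCommGroup.induced (HSpace s) _ (HSpace.toL2 s) (HSpace.toL2_injective s)

instance (s : ℝ) : NormedSpace ℝ (HSpace s) := NormedSpace.induced ℝ _ _ (HSpace.toL2 s)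

/-- The norm `‖w‖_{V^s} = (∑ₖ |wₖ|² |k|^{2s})^{1/2}`, i.e. the `ℓ²` norm of `Λ^s w`. -/
instance (s : ℝ) : NormedAddCommGroup (VSpace s) :=
  NormedAddCommGroup.induced (VSpace s) _ (VSpace.toL2 s) (VSpace.toL2_injective s)

instance (s : ℝ) : NormedSpace ℝ (VSpace s) := NormedSpace.induced ℝ _ _ (VSpace.toL2 s)

/-! ### Pairings and trilinear forms -/

/-- The pairing `⟨f, g⟩ = ∑ₖ fₖ g₋ₖ`. -/
def pairH (f g : ScalarSeries) : ℂ := ∑' k, f k * g (-k)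

/-- The pairing `⟨v, w⟩ = ∑ₖ vₖ · w₋ₖ`. -/
def pairV (v w : VectorSeries) : ℂ := ∑' k, ∑ i, v k i * w (-k) i

/-- The vector series `θ e₃`. -/
def timesE3 (θ : ScalarSeries) : VectorSeries := fun k => EuclideanSpace.single 2 (θ k)

/-- Lebesgue measure on the box `[0, 2π]³`. -/
def boxMeasure : Measure (Fin 3 → ℝ) :=
  volume.restrict (Icc (fun _ => 0) (fun _ => 2 * Real.pi))

/-- The character `e^{i k·x}`. -/
def character (k : Freq) (x : Fin 3 → ℝ) : ℂ :=
  Complex.exp (Complex.I * ∑ i, (k i : ℂ) * (x i : ℂ))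

/-- `F` is the sum of the series `∑ₖ fₖ e^{i k·x}` in `L²([0, 2π]³)`. -/
def IsSumOf (f : ScalarSeries) (F : (Fin 3 → ℝ) → ℂ) : Prop :=
  MemLp F 2 boxMeasure ∧
    Tendsto (fun S : Finset Freq =>
      eLpNorm (fun x => F x - ∑ k ∈ S, f k * character k x) 2 boxMeasure) atTop (𝓝 0)

open Classical in
/-- The function on `[0, 2π]³` (unique up to null sets) with Fourier series `f`, when `f` has square
summable coefficients. -/
def toFn (f : ScalarSeries) : (Fin 3 → ℝ) → ℂ :=
  if h : ∃ F, IsSumOf f F then h.choose else 0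

/-- The partial derivative `∂_j f`, with coefficients `i k_j fₖ`. -/
def pderiv (j : Fin 3) (f : ScalarSeries) : ScalarSeries := fun k => Complex.I * (k j : ℂ) * f k

/-- The `i`-th component of a vector series. -/
def component (i : Fin 3) (w : VectorSeries) : ScalarSeries := fun k => w k i

/-- `⟨u · ∇φ, θ⟩ = ∫ (u · ∇φ) θ dx`, with `dx` normalised to total mass one so that the
integral agrees with the pairing `∑ₖ fₖ g₋ₖ`. -/
def transportForm (u : VectorSeries) (φ θ : ScalarSeries) : ℂ :=
  ((2 * Real.pi : ℂ) ^ 3)⁻¹ * ∫ x, (∑ j, toFn (component j u) x * toFn (pderiv j φ) x) *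
    toFn θ x ∂boxMeasure

/-- `⟨B(u, v), w⟩ = ∫ ((u · ∇) v) · w dx`, with the same normalisation of `dx`. -/
def trilinB (u v w : VectorSeries) : ℂ :=
  ((2 * Real.pi : ℂ) ^ 3)⁻¹ * ∫ x, ∑ i,
    (∑ j, toFn (component j u) x * toFn (pderiv j (component i v)) x) *
      toFn (component i w) x ∂boxMeasure

/-! ### Classes of time dependent series -/

/-- `v ∈ C([0, T]; X)`, where `c : X → S` is the inclusion of `X` in the formal series. -/
def MemC {X S : Type*} [TopologicalSpace X] (c : X → S) (T : ℝ) (v : ℝ → S) : Prop :=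
  ∃ w : ℝ → X, ContinuousOn w (Icc 0 T) ∧ ∀ t ∈ Icc 0 T, c (w t) = v t

/-- `v ∈ C_w([0, T]; X)`: continuity for the weak topology of `X`. -/
def MemCw {X S : Type*} [NormedAddCommGroup X] [NormedSpace ℝ X] (c : X → S) (T : ℝ)
    (v : ℝ → S) : Prop :=
  ∃ w : ℝ → X, (∀ l : X →L[ℝ] ℝ, ContinuousOn (fun t => l (w t)) (Icc 0 T)) ∧
    ∀ t ∈ Icc 0 T, c (w t) = v t

/-- `v ∈ L^p(0, T; X)` (Bochner space). -/
def MemLpTime {X S : Type*} [NormedAddCommGroup X] (c : X → S) (p : ℝ≥0∞) (T : ℝ)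
    (v : ℝ → S) : Prop :=
  ∃ w : ℝ → X, MemLp w p (volume.restrict (Icc 0 T)) ∧
    ∀ᵐ t ∂volume.restrict (Icc 0 T), c (w t) = v t

/-! ### Solutions -/

/-- `(v, θ)` is a weak solution on `[0, T]`, with initial data `v₀ ∈ V⁰`, `θ₀ ∈ H⁰`, of
`∂ₜv + B(u, v) + ν Λ^{2β} v = Π(θ e₃)`, `∂ₜθ + u · ∇θ = 0`, `v = Λ^{2α} u`. -/
structure IsWeakSolution (α β ν T : ℝ) (v₀ : VectorSeries) (θ₀ : ScalarSeries)
    (v : ℝ → VectorSeries) (θ : ℝ → ScalarSeries) : Prop where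
  v₀_mem : v₀ ∈ VSub 0
  θ₀_mem : θ₀ ∈ HSub 0
  v_bounded : MemLpTime (VSpace.coeff (s := 0)) ∞ T v
  v_L2 : MemLpTime (VSpace.coeff (s := β)) 2 T v
  v_weakCont : MemCw (VSpace.coeff (s := 0)) T v
  θ_bounded : MemLpTime (HSpace.coeff (s := 0)) ∞ T θ
  θ_weakCont : MemCw (HSpace.coeff (s := 0)) T θ
  velocity : ∀ ψ : VSpace (5 / 2), ∀ t ∈ Icc 0 T,
    pairV (v t) ψ.coeff - (∫ s in (0 : ℝ)..t, trilinB (Lam (-2 * α) (v s)) ψ.coeff (v s))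
      + ν * (∫ s in (0 : ℝ)..t, pairV (Lam β (v s)) (Lam β ψ.coeff))
    = pairV v₀ ψ.coeff + ∫ s in (0 : ℝ)..t, pairV (timesE3 (θ s)) ψ.coeff
  temperature : ∀ φ : HSpace (5 / 2), ∀ t ∈ Icc 0 T,
    pairH (θ t) φ.coeff - (∫ s in (0 : ℝ)..t, transportForm (Lam (-2 * α) (v s)) φ.coeff (θ s))
    = pairH θ₀ φ.coeff

/-- A regular solution: a weak solution with `v ∈ C([0, T]; V^r) ∩ L²(0, T; V^{r+β})` and
`θ ∈ C([0, T]; H^{r-β})`. -/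
structure IsRegularSolution (α β ν r T : ℝ) (v₀ : VectorSeries) (θ₀ : ScalarSeries)
    (v : ℝ → VectorSeries) (θ : ℝ → ScalarSeries) : Prop where
  weak : IsWeakSolution α β ν T v₀ θ₀ v θ
  v_cont : MemC (VSpace.coeff (s := r)) T v
  v_L2 : MemLpTime (VSpace.coeff (s := r + β)) 2 T v
  θ_cont : MemC (HSpace.coeff (s := r - β)) T θ

end

end Boussinesq

namespace Boussinesq

open MeasureTheory Filter Topology Set
open scoped ENNReal ComplexConjugate

noncomputable section

/-! ### Lattice sums and convolution inequalities -/

/-! Uniqueness is an L² energy estimate for the difference v = v₁ - v₂, θ = θ₁ - θ₂, closed by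
Gronwall. Each transport difference splits as (u₁ - u₂)·∇f₁ + u₂·∇(f₁ - f₂), with f a component of
the velocity or the temperature. Paired with f₁ - f₂, the second term vanishes, because transport by
a divergence-free field is antisymmetric. The first is bounded by the product estimate H^a × H^{q-1}
→ L², valid for a + q - 1 > 3/2, with q = r - β and a = β + 2α. This a gives ‖u₁ - u₂‖_a = ‖v‖_β,
which is the norm controlled by the dissipation; Young's inequality absorbs it and leaves d/dt(‖v‖²
+ ‖θ‖²) ≤ C(‖v‖² + ‖θ‖²). The condition r > β + 1 makes q - 1 nonnegative, and r > 2β is the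
condition a + q > 5/2, since α + β = 5/4.

Everything is done on Fourier coefficients. Two-mode test functions turn the weak formulation into
an integral equation for each coefficient (`IsWeakSolution.temperature_mode`,
`IsWeakSolution.velocity_coeff`), with a right-hand side continuous in time, so each mode has a
classical energy identity (`mode_energy_eq_integral`). Summing over modes needs a bound on the
absolute sum of the rates, uniform in time, for dominated convergence; the Gronwall bound needs the
signed sum, where the cancellation lives. `exists_energyRate_bound` provides both and
`tsum_eq_zero_of_rate_le` concludes. -/

theorem freqNorm_nonneg (k : Freq) : 0 ≤ freqNorm k := Real.sqrt_nonneg _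

theorem freqNorm_neg (k : Freq) : freqNorm (-k) = freqNorm k := by simp [freqNorm]

theorem freqNorm_sq (k : Freq) : freqNorm k ^ 2 = ∑ i, (k i : ℝ) ^ 2 :=
  Real.sq_sqrt (Finset.sum_nonneg fun _ _ => sq_nonneg _)

theorem abs_le_freqNorm (k : Freq) (i : Fin 3) : |(k i : ℝ)| ≤ freqNorm k := by
  rw [freqNorm, ← Real.sqrt_sq_eq_abs]
  exact Real.sqrt_le_sqrt
    (Finset.single_le_sum (f := fun i => (k i : ℝ) ^ 2) (fun j _ => sq_nonneg _)
      (Finset.mem_univ i))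

theorem one_le_freqNorm {k : Freq} (hk : k ≠ 0) : 1 ≤ freqNorm k := by
  obtain ⟨i, hi⟩ := Function.ne_iff.1 hk
  refine le_trans ?_ (abs_le_freqNorm k i)
  exact_mod_cast Int.one_le_abs hi

/-- Transferred from the ℤ-span of the standard basis of Euclidean ℝ³, a lattice of rank 3, on which
powers of the norm below minus the rank are summable. -/
theorem summable_freqNorm_rpow {s : ℝ} (hs : s < -3) : Summable fun k : Freq => freqNorm k ^ s := by
  let b : Module.Basis (Fin 3) ℝ (EuclideanSpace ℝ (Fin 3)) :=
    (EuclideanSpace.basisFun (Fin 3) ℝ).toBasis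
  let L : Submodule ℤ (EuclideanSpace ℝ (Fin 3)) := Submodule.span ℤ (Set.range b)
  have hL : Module.finrank ℤ L = 3 := by
    rw [ZLattice.rank ℝ L]; simp
  have h := ZLattice.summable_norm_rpow L s (by rw [hL]; exact_mod_cast hs)
  let φ : Freq → L := fun k => ⟨∑ i, k i • b i,
    Submodule.sum_mem _ fun i _ => Submodule.smul_mem _ _ (Submodule.subset_span ⟨i, rfl⟩)⟩
  have hφ : ∀ k i, (φ k : EuclideanSpace ℝ (Fin 3)) i = k i := by
    intro k i
    simp [φ, b, Finset.sum_apply, Pi.single_apply]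
  have hinj : Function.Injective φ := by
    intro k l hkl
    funext i
    have := hφ k i
    rw [hkl, hφ l i] at this
    exact Int.cast_injective (α := ℝ) this.symm
  refine (h.comp_injective hinj).congr fun k => ?_
  have : ‖φ k‖ = freqNorm k := by
    rw [Submodule.coe_norm, EuclideanSpace.norm_eq, freqNorm]
    simp [hφ]
  simp only [Function.comp_apply, this]

theorem summable_mul_and_tsum_le {ι : Type*} {f g : ι → ℝ} (hf : ∀ i, 0 ≤ f i) (hg : ∀ i, 0 ≤ g i)
    (hf2 : Summable fun i => f i ^ 2) (hg2 : Summable fun i => g i ^ 2) :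
    (Summable fun i => f i * g i) ∧
      ∑' i, f i * g i ≤ √(∑' i, f i ^ 2) * √(∑' i, g i ^ 2) := by
  have := Real.summable_and_inner_le_Lp_mul_Lq_tsum_of_nonneg Real.HolderConjugate.two_two hf hg
    (by simpa using hf2) (by simpa using hg2)
  simpa [Real.sqrt_eq_rpow] using this

/-- Young's inequality `ℓ¹ * ℓ² ⊆ ℓ²` in trilinear form. -/
theorem young_trilinear {A G h : Freq → ℝ} (hA : ∀ k, 0 ≤ A k) (hG : ∀ k, 0 ≤ G k)
    (hh : ∀ k, 0 ≤ h k) (hA1 : Summable A) (hG2 : Summable fun k => G k ^ 2)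
    (hh2 : Summable fun k => h k ^ 2) :
    (Summable fun p : Freq × Freq => A p.2 * G (p.1 - p.2) * h p.1) ∧
      ∑' p : Freq × Freq, A p.2 * G (p.1 - p.2) * h p.1 ≤
        (∑' k, A k) * (√(∑' k, G k ^ 2) * √(∑' k, h k ^ 2)) := by
  set K := √(∑' k, G k ^ 2) * √(∑' k, h k ^ 2)
  -- For fixed l this is Cauchy–Schwarz in k, with a constant independent of l because the ℓ² norm
  -- of G is translation invariant; what remains is the sum of A.
  have key : ∀ l, (Summable fun k => A l * G (k - l) * h k) ∧
      ∑' k, A l * G (k - l) * h k ≤ A l * K := by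
    intro l
    have h1 : Summable fun k => G (k - l) ^ 2 :=
      (Equiv.subRight l).summable_iff.2 hG2
    have h2 : ∑' k, G (k - l) ^ 2 = ∑' k, G k ^ 2 :=
      (Equiv.subRight l).tsum_eq fun k => G k ^ 2
    have h3 := summable_mul_and_tsum_le (fun k => hG (k - l)) hh h1 hh2
    rw [h2] at h3
    simp_rw [mul_assoc]
    exact ⟨h3.1.mul_left _, by rw [tsum_mul_left]; exact mul_le_mul_of_nonneg_left h3.2 (hA l)⟩
  let F : Freq × Freq → ℝ := fun p => A p.1 * G (p.2 - p.1) * h p.2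
  have hF0 : 0 ≤ F := fun p => mul_nonneg (mul_nonneg (hA _) (hG _)) (hh _)
  have hs : Summable fun l => ∑' k, F (l, k) :=
    Summable.of_nonneg_of_le (fun l => tsum_nonneg fun k => hF0 (l, k)) (fun l => (key l).2)
      (hA1.mul_right K)
  have hF : Summable F := (summable_prod_of_nonneg hF0).2 ⟨fun l => (key l).1, hs⟩
  have hF' : ∑' p, F p ≤ (∑' k, A k) * K := by
    rw [hF.tsum_prod, ← tsum_mul_right]
    exact hs.tsum_le_tsum (fun l => (key l).2) (hA1.mul_right K)
  refine ⟨(Equiv.prodComm Freq Freq).summable_iff.2 hF, ?_⟩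
  exact ((Equiv.prodComm Freq Freq).tsum_eq F).le.trans hF'

/-- The involution `(k, l) ↦ (k, k - l)` of `ℤ³ × ℤ³`. -/
def subEquiv : Freq × Freq ≃ Freq × Freq where
  toFun p := (p.1, p.1 - p.2)
  invFun p := (p.1, p.1 - p.2)
  left_inv p := by simp
  right_inv p := by simp

/-- The `ℓ²` norm of `Λ^s f`, for a real sequence `f`. -/
def weightedNorm (s : ℝ) (f : Freq → ℝ) : ℝ := √(∑' k, f k ^ 2 * freqNorm k ^ (2 * s))

theorem weightedNorm_nonneg (s : ℝ) (f : Freq → ℝ) : 0 ≤ weightedNorm s f := Real.sqrt_nonneg _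

/-- The embedding of H^σ into absolutely convergent Fourier series, written for F = Λ^σ f:
Cauchy–Schwarz against |k|^(-σ), square summable as 2σ > 3. -/
theorem exists_weighted_l1_bound {σ : ℝ} (hσ : 3 / 2 < σ) :
    ∃ C, 0 ≤ C ∧ ∀ F : Freq → ℝ, (∀ k, 0 ≤ F k) → (Summable fun k => F k ^ 2) →
      (Summable fun k => freqNorm k ^ (-σ) * F k) ∧
        ∑' k, freqNorm k ^ (-σ) * F k ≤ C * √(∑' k, F k ^ 2) := by
  refine ⟨√(∑' k : Freq, (freqNorm k ^ (-σ)) ^ 2), Real.sqrt_nonneg _, fun F hF hF2 => ?_⟩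
  refine summable_mul_and_tsum_le (fun k => Real.rpow_nonneg (freqNorm_nonneg k) _) hF ?_ hF2
  refine (summable_freqNorm_rpow (s := -(2 * σ)) (by linarith)).congr fun k => ?_
  rw [← Real.rpow_natCast, ← Real.rpow_mul (freqNorm_nonneg k)]
  congr 1; push_cast; ring

/-- The product estimate `H^a × H^b → L²`, `a + b > 3/2`, in trilinear form. -/
theorem exists_trilinear_bound {a b : ℝ} (ha : 0 ≤ a) (hb : 0 ≤ b) (hab : 3 / 2 < a + b) :
    ∃ C, 0 ≤ C ∧ ∀ f g h : Freq → ℝ, (∀ k, 0 ≤ f k) → (∀ k, 0 ≤ g k) → (∀ k, 0 ≤ h k) →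
      f 0 = 0 → g 0 = 0 → (Summable fun k => f k ^ 2 * freqNorm k ^ (2 * a)) →
      (Summable fun k => g k ^ 2 * freqNorm k ^ (2 * b)) → (Summable fun k => h k ^ 2) →
      (Summable fun p : Freq × Freq => f p.2 * g (p.1 - p.2) * h p.1) ∧
        ∑' p : Freq × Freq, f p.2 * g (p.1 - p.2) * h p.1 ≤
          C * (weightedNorm a f * weightedNorm b g * √(∑' k, h k ^ 2)) := by
  obtain ⟨C, hC0, hC⟩ := exists_weighted_l1_bound hab
  refine ⟨2 * C, by positivity, fun f g h hf hg hh f0 g0 hfs hgs hhs => ?_⟩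
  have hn : ∀ (k : Freq) (s : ℝ), 0 ≤ freqNorm k ^ s :=
    fun k s => Real.rpow_nonneg (freqNorm_nonneg k) _
  have hsq : ∀ (s : ℝ) (e : Freq → ℝ) (k : Freq),
      (freqNorm k ^ s * e k) ^ 2 = e k ^ 2 * freqNorm k ^ (2 * s) := by
    intro s e k
    rw [mul_pow, ← Real.rpow_natCast (freqNorm k ^ s), ← Real.rpow_mul (freqNorm_nonneg k),
      mul_comm]
    congr 2; push_cast; ring
  set σ := a + b
  set F : Freq → ℝ := fun k => freqNorm k ^ a * f k
  set G : Freq → ℝ := fun k => freqNorm k ^ b * g k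
  have hF0 : ∀ k, 0 ≤ F k := fun k => mul_nonneg (hn k a) (hf k)
  have hG0 : ∀ k, 0 ≤ G k := fun k => mul_nonneg (hn k b) (hg k)
  have hF2 : Summable fun k => F k ^ 2 := hfs.congr fun k => (hsq a f k).symm
  have hG2 : Summable fun k => G k ^ 2 := hgs.congr fun k => (hsq b g k).symm
  have hFn : √(∑' k, F k ^ 2) = weightedNorm a f := by
    rw [weightedNorm, tsum_congr fun k => hsq a f k]
  have hGn : √(∑' k, G k ^ 2) = weightedNorm b g := by
    rw [weightedNorm, tsum_congr fun k => hsq b g k]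
  have hcF := hC F hF0 hF2
  have hcG := hC G hG0 hG2
  rw [hFn] at hcF
  rw [hGn] at hcG
  -- Whichever factor sits at the lower frequency receives the whole weight of order -σ and lies in
  -- ℓ¹; the other stays in ℓ². The two cases account for the constant 2 * C, and `subEquiv`
  -- exchanges the frequencies of f and g in the second.
  have y1 := young_trilinear (fun k => mul_nonneg (hn k (-σ)) (hF0 k)) hG0 hh hcF.1 hG2 hhs
  have y2 := young_trilinear (fun k => mul_nonneg (hn k (-σ)) (hG0 k)) hF0 hh hcG.1 hF2 hhs
  rw [hFn] at y2
  rw [hGn] at y1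
  let Y1 : Freq × Freq → ℝ := fun p => freqNorm p.2 ^ (-σ) * F p.2 * G (p.1 - p.2) * h p.1
  let Y2 : Freq × Freq → ℝ := fun p => freqNorm p.2 ^ (-σ) * G p.2 * F (p.1 - p.2) * h p.1
  have s1 : Summable Y1 := y1.1
  have s2 : Summable fun p => Y2 (subEquiv p) := subEquiv.summable_iff.2 y2.1
  have t2 : ∑' p, Y2 (subEquiv p) = ∑' p, Y2 p := subEquiv.tsum_eq Y2
  have hpt : ∀ p : Freq × Freq, f p.2 * g (p.1 - p.2) * h p.1 ≤ Y1 p + Y2 (subEquiv p) := by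
    rintro ⟨k, l⟩
    have e : Y1 (k, l) + Y2 (subEquiv (k, l)) =
        (freqNorm l ^ (-σ) + freqNorm (k - l) ^ (-σ)) * (F l * G (k - l)) * h k := by
      simp only [Y1, Y2, subEquiv, Equiv.coe_fn_mk, sub_sub_cancel]; ring
    rw [e]
    refine mul_le_mul_of_nonneg_right ?_ (hh k)
    -- Zero frequencies are set apart because `0 ^ (-σ) = 0` in Lean, so the weight inequality `hw`
    -- can fail there; the mean-zero conditions make the left side vanish instead.
    rcases eq_or_ne l 0 with rfl | hl
    · simp only [f0, zero_mul]
      exact mul_nonneg (add_nonneg (hn _ _) (hn _ _)) (mul_nonneg (hF0 _) (hG0 _))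
    rcases eq_or_ne (k - l) 0 with hm | hm
    · rw [hm]; simp only [g0, mul_zero]
      exact mul_nonneg (add_nonneg (hn _ _) (hn _ _)) (mul_nonneg (hF0 _) (hG0 _))
    have pl := freqNorm_pos hl
    have pm := freqNorm_pos hm
    have hw : 1 ≤ (freqNorm l ^ (-σ) + freqNorm (k - l) ^ (-σ)) *
        (freqNorm l ^ a * freqNorm (k - l) ^ b) := by
      rcases le_total (freqNorm l) (freqNorm (k - l)) with hle | hle
      · have h1 : freqNorm l ^ b ≤ freqNorm (k - l) ^ b := Real.rpow_le_rpow pl.le hle hb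
        have h2 : freqNorm l ^ (-σ) * (freqNorm l ^ a * freqNorm l ^ b) = 1 := by
          rw [← Real.rpow_add pl, ← Real.rpow_add pl]; simp [σ]
        calc 1 = freqNorm l ^ (-σ) * (freqNorm l ^ a * freqNorm l ^ b) := h2.symm
          _ ≤ _ := mul_le_mul (le_add_of_nonneg_right (hn _ _))
            (mul_le_mul_of_nonneg_left h1 (hn _ _)) (mul_nonneg (hn _ _) (hn _ _))
            (add_nonneg (hn _ _) (hn _ _))
      · have h1 : freqNorm (k - l) ^ a ≤ freqNorm l ^ a := Real.rpow_le_rpow pm.le hle ha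
        have h2 : freqNorm (k - l) ^ (-σ) * (freqNorm (k - l) ^ a * freqNorm (k - l) ^ b) = 1 := by
          rw [← Real.rpow_add pm, ← Real.rpow_add pm]; simp [σ]
        calc 1 = _ := h2.symm
          _ ≤ _ := mul_le_mul (le_add_of_nonneg_left (hn _ _))
            (mul_le_mul_of_nonneg_right h1 (hn _ _)) (mul_nonneg (hn _ _) (hn _ _))
            (add_nonneg (hn _ _) (hn _ _))
    calc f l * g (k - l) = 1 * (f l * g (k - l)) := by ring
      _ ≤ _ := mul_le_mul_of_nonneg_right hw (mul_nonneg (hf _) (hg _))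
      _ = _ := by simp only [F, G]; ring
  have hs := Summable.of_nonneg_of_le
    (fun p : Freq × Freq => mul_nonneg (mul_nonneg (hf _) (hg _)) (hh _)) hpt (s1.add s2)
  refine ⟨hs, (hs.tsum_le_tsum hpt (s1.add s2)).trans ?_⟩
  rw [Summable.tsum_add s1 s2]
  have hKG : 0 ≤ weightedNorm b g * √(∑' k, h k ^ 2) :=
    mul_nonneg (weightedNorm_nonneg _ _) (Real.sqrt_nonneg _)
  have hKF : 0 ≤ weightedNorm a f * √(∑' k, h k ^ 2) :=
    mul_nonneg (weightedNorm_nonneg _ _) (Real.sqrt_nonneg _)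
  have z1 := y1.2.trans (mul_le_mul_of_nonneg_right hcF.2 hKG)
  have z2 := y2.2.trans (mul_le_mul_of_nonneg_right hcG.2 hKF)
  calc _ ≤ _ := add_le_add z1 (t2.le.trans z2)
    _ = _ := by ring

/-! ### Fourier series in `L²` of the box -/

instance : IsFiniteMeasure boxMeasure :=
  ⟨by rw [boxMeasure, Measure.restrict_apply_univ]; exact isCompact_Icc.measure_lt_top⟩

theorem continuous_character (k : Freq) : Continuous (character k) := by
  unfold character; fun_prop

theorem norm_character (k : Freq) (x : Fin 3 → ℝ) : ‖character k x‖ = 1 := by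
  have : Complex.I * ∑ i, (k i : ℂ) * (x i : ℂ) = ((∑ i, (k i : ℝ) * x i : ℝ) : ℂ) * Complex.I := by
    push_cast; ring
  rw [character, this, Complex.norm_exp_ofReal_mul_I]

theorem character_add (k l : Freq) (x : Fin 3 → ℝ) :
    character (k + l) x = character k x * character l x := by
  simp only [character, ← Complex.exp_add, ← mul_add, ← Finset.sum_add_distrib]
  simp [add_mul]

theorem conj_character (k : Freq) (x : Fin 3 → ℝ) : conj (character k x) = character (-k) x := by
  simp [character, ← Complex.exp_conj]

theorem memLp_character (k : Freq) (p : ℝ≥0∞) : MemLp (character k) p boxMeasure :=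
  MemLp.of_bound (continuous_character k).aestronglyMeasurable 1
    (Eventually.of_forall fun x => (norm_character k x).le)

theorem integral_character (k : Freq) :
    ∫ x, character k x ∂boxMeasure = if k = 0 then (2 * Real.pi : ℂ) ^ 3 else 0 := by
  have hbox : boxMeasure = Measure.pi fun _ : Fin 3 => volume.restrict (Icc 0 (2 * Real.pi)) := by
    rw [boxMeasure, ← pi_univ_Icc, volume_pi, Measure.restrict_pi_pi]
  have hchar : ∀ x, character k x = ∏ i, Complex.exp (Complex.I * k i * x i) := fun x => by
    rw [character, Finset.mul_sum, Complex.exp_sum]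
    simp [mul_assoc]
  have h1 : ∀ n : ℤ, ∫ x : ℝ in Icc 0 (2 * Real.pi), Complex.exp (Complex.I * n * x) =
      if n = 0 then (2 * Real.pi : ℂ) else 0 := by
    intro n
    rw [integral_Icc_eq_integral_Ioc, ← intervalIntegral.integral_of_le Real.two_pi_pos.le]
    split_ifs with hn
    · simp [hn]
    · have hc : Complex.I * n ≠ 0 := mul_ne_zero Complex.I_ne_zero (by exact_mod_cast hn)
      rw [integral_exp_mul_complex hc]
      have : Complex.I * n * ((2 * Real.pi : ℝ) : ℂ) = n * (2 * Real.pi * Complex.I) := by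
        push_cast; ring
      rw [this, Complex.exp_int_mul_two_pi_mul_I]
      simp
  simp_rw [hchar]
  rw [hbox, integral_fintype_prod_eq_prod (𝕜 := ℂ)
    (f := fun i (x : ℝ) => Complex.exp (Complex.I * k i * x))]
  simp_rw [h1]
  split_ifs with hk
  · simp [hk]
  · obtain ⟨i, hi⟩ := Function.ne_iff.1 hk
    exact Finset.prod_eq_zero (Finset.mem_univ i) (if_neg hi)

/-- Riesz–Fischer: the normalised characters are orthonormal in L², so square summable coefficients
sum to an L² function. Completeness of the characters plays no role. -/
theorem exists_isSumOf {f : ScalarSeries} (hf : Summable fun k => ‖f k‖ ^ 2) :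
    ∃ F, IsSumOf f F := by
  -- The L² norm of a character on the box; relative to the orthonormal family the coefficients
  -- become c * f k.
  set c : ℂ := ((√((2 * Real.pi) ^ 3) : ℝ) : ℂ)
  have hc2 : c * c = (2 * Real.pi : ℂ) ^ 3 := by
    rw [← Complex.ofReal_mul, Real.mul_self_sqrt (by positivity)]; push_cast; rfl
  have hc0 : c ≠ 0 := by
    have : (2 * Real.pi : ℂ) ^ 3 ≠ 0 := pow_ne_zero _ (by exact_mod_cast Real.two_pi_pos.ne')
    rw [← hc2] at this
    exact left_ne_zero_of_mul this
  have hcc : conj c = c := Complex.conj_ofReal _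
  have hm : ∀ k, MemLp (fun x => c⁻¹ * character k x) 2 boxMeasure :=
    fun k => (memLp_character k 2).const_mul _
  let e : Freq → Lp ℂ 2 boxMeasure := fun k => (hm k).toLp
  have he : Orthonormal ℂ e := by
    rw [orthonormal_iff_ite]
    intro k l
    rw [L2.inner_def]
    have : ∀ᵐ x ∂boxMeasure, inner ℂ (e k x) (e l x) =
        ((2 * Real.pi : ℂ) ^ 3)⁻¹ * character (l - k) x := by
      filter_upwards [(hm k).coeFn_toLp, (hm l).coeFn_toLp] with x h1 h2
      rw [h1, h2, RCLike.inner_apply, map_mul, conj_character, map_inv₀, hcc, sub_eq_add_neg,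
        character_add, ← hc2, mul_inv]
      ring
    rw [integral_congr_ae this, integral_const_mul, integral_character]
    have h0 : (2 * Real.pi : ℂ) ^ 3 ≠ 0 := by rw [← hc2]; exact mul_ne_zero hc0 hc0
    by_cases hkl : k = l
    · simp [hkl, h0]
    · simp [hkl, sub_eq_zero, Ne.symm hkl]
  have hfl : Memℓp (fun k => c * f k) 2 := by
    rw [memℓp_gen_iff (by norm_num)]
    refine (hf.mul_left (‖c‖ ^ 2)).congr fun k => ?_
    simp [mul_pow]
  have hs := he.orthogonalFamily.hasSum_linearIsometry ⟨_, hfl⟩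
  set F := he.orthogonalFamily.linearIsometry ⟨_, hfl⟩
  refine ⟨F, Lp.memLp F, ?_⟩
  have h1 := tendsto_iff_edist_tendsto_0.1 hs
  refine h1.congr fun S => ?_
  rw [edist_comm, Lp.edist_def]
  refine eLpNorm_congr_ae ?_
  have h2 : ∀ᵐ x ∂boxMeasure, (∑ k ∈ S, (c * f k) • e k : Lp ℂ 2 boxMeasure) x =
      ∑ k ∈ S, f k * character k x := by
    have h3 : ∀ᵐ x ∂boxMeasure, ∀ k, ((c * f k) • e k : Lp ℂ 2 boxMeasure) x =
        f k * character k x := by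
      rw [ae_all_iff]
      intro k
      filter_upwards [Lp.coeFn_smul (c * f k) (e k), (hm k).coeFn_toLp] with x h4 h5
      rw [h4, Pi.smul_apply, h5, smul_eq_mul]
      field_simp
    filter_upwards [h3, Lp.coeFn_finsetSum S fun k => (c * f k) • e k] with x h6 h7
    rw [h7, Finset.sum_apply]
    exact Finset.sum_congr rfl fun k _ => h6 k
  filter_upwards [h2] with x hx
  rw [Pi.sub_apply, ← hx]
  rfl

theorem isSumOf_toFn {f : ScalarSeries} (hf : Summable fun k => ‖f k‖ ^ 2) :
    IsSumOf f (toFn f) := by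
  have h := exists_isSumOf hf
  rw [toFn, dif_pos h]
  exact h.choose_spec

/-- By Hölder, L² convergence of the partial sums gives L¹ convergence after multiplication by H. -/
theorem IsSumOf.hasSum_integral_mul {f : ScalarSeries} {F H : (Fin 3 → ℝ) → ℂ} (hF : IsSumOf f F)
    (hH : MemLp H 2 boxMeasure) :
    HasSum (fun k => f k * ∫ x, character k x * H x ∂boxMeasure)
      (∫ x, F x * H x ∂boxMeasure) := by
  have hint : ∀ k, Integrable (fun x => f k * (character k x * H x)) boxMeasure := fun k =>
    ((memLp_character k 2).integrable_mul hH).const_mul _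
  have hS : ∀ S : Finset Freq, MemLp (fun x => ∑ k ∈ S, f k * character k x) 2 boxMeasure :=
    fun S => memLp_finsetSum S fun k _ => (memLp_character k 2).const_mul _
  have key : Tendsto (fun S : Finset Freq =>
      ∫ x, (∑ k ∈ S, f k * character k x) * H x ∂boxMeasure) atTop
      (𝓝 (∫ x, F x * H x ∂boxMeasure)) := by
    refine tendsto_integral_of_L1' _ (hF.1.integrable_mul hH).aestronglyMeasurable
      (Eventually.of_forall fun S => (hS S).integrable_mul hH) ?_
    have h0 : Tendsto (fun S : Finset Freq =>
        eLpNorm (fun x => F x - ∑ k ∈ S, f k * character k x) 2 boxMeasure *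
          eLpNorm H 2 boxMeasure) atTop (𝓝 0) := by
      have := ENNReal.Tendsto.mul_const hF.2 (b := eLpNorm H 2 boxMeasure) (Or.inr hH.2.ne)
      rwa [zero_mul] at this
    refine tendsto_of_tendsto_of_tendsto_of_le_of_le tendsto_const_nhds h0
      (fun _ => zero_le) fun S => ?_
    have h1 := eLpNorm_smul_le_mul_eLpNorm (p := 2) (q := 2) (r := 1) hH.1 ((hF.1.sub (hS S)).1)
    refine le_trans (le_of_eq ?_) h1
    rw [← eLpNorm_neg]
    congr 1
    funext x
    simp only [Pi.neg_apply, Pi.sub_apply, Pi.smul_apply', Pi.mul_apply, smul_eq_mul]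
    ring
  refine key.congr fun S => ?_
  simp_rw [Finset.sum_mul, mul_assoc]
  rw [integral_finsetSum S fun k _ => hint k]
  simp_rw [integral_const_mul]

theorem IsSumOf.integral_mul_character {f : ScalarSeries} {F : (Fin 3 → ℝ) → ℂ} (hF : IsSumOf f F)
    (m : Freq) : ∫ x, F x * character m x ∂boxMeasure = (2 * Real.pi : ℂ) ^ 3 * f (-m) := by
  have h := hF.hasSum_integral_mul (memLp_character m 2)
  simp_rw [← character_add, integral_character] at h
  refine h.unique ?_
  have := hasSum_single (f := fun k => f k * if k + m = 0 then (2 * Real.pi : ℂ) ^ 3 else 0) (-m)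
    fun k hk => by simp [add_eq_zero_iff_eq_neg, hk]
  simpa [mul_comm] using this

theorem IsSumOf.hasSum_integral_triple {f g : ScalarSeries} {F G : (Fin 3 → ℝ) → ℂ}
    (hF : IsSumOf f F) (hG : IsSumOf g G) (m : Freq) :
    HasSum (fun l => (2 * Real.pi : ℂ) ^ 3 * (f l * g (-m - l)))
      (∫ x, F x * (character m x * G x) ∂boxMeasure) := by
  have hH : MemLp (fun x => character m x * G x) 2 boxMeasure :=
    hG.1.mul (memLp_character m ⊤)
  refine (hF.hasSum_integral_mul hH).congr_fun fun l => ?_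
  have : ∫ x, character l x * (character m x * G x) ∂boxMeasure =
      ∫ x, G x * character (m + l) x ∂boxMeasure :=
    integral_congr_ae (Eventually.of_forall fun x => by simp only [character_add]; ring)
  rw [this, hG.integral_mul_character, neg_add']
  ring

/-- `toFn` is an arbitrary representative, so only an almost everywhere identity can hold. The
partial sums are eventually constant, hence their L² error equals its limit 0. -/
theorem toFn_of_support {p : ScalarSeries} {S : Finset Freq} (hS : ∀ k ∉ S, p k = 0) :
    toFn p =ᵐ[boxMeasure] fun x => ∑ k ∈ S, p k * character k x := by
  have hp : Summable fun k => ‖p k‖ ^ 2 :=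
    summable_of_ne_finset_zero (s := S) fun k hk => by simp [hS k hk]
  have h := isSumOf_toFn hp
  have hlim : Tendsto (fun A : Finset Freq =>
      eLpNorm (fun x => toFn p x - ∑ k ∈ A, p k * character k x) 2 boxMeasure) atTop
      (𝓝 (eLpNorm (fun x => toFn p x - ∑ k ∈ S, p k * character k x) 2 boxMeasure)) := by
    refine tendsto_const_nhds.congr' ?_
    filter_upwards [eventually_ge_atTop S] with A hA
    congr 1
    funext x
    rw [Finset.sum_subset hA fun k _ hk => by simp [hS k hk]]
  have h0 := tendsto_nhds_unique hlim h.2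
  have hm : MemLp (fun x => ∑ k ∈ S, p k * character k x) 2 boxMeasure :=
    memLp_finsetSum S fun k _ => (memLp_character k 2).const_mul _
  filter_upwards [(eLpNorm_eq_zero_iff (h.1.sub hm).1 two_ne_zero).1 h0] with x hx
  exact sub_eq_zero.1 hx

/-- A product of three L² functions need not be integrable; finite support makes the middle factor a
trigonometric polynomial, hence bounded. Integrability is recorded so that finite sums over
components can later leave the integral. -/
theorem integral_toFn_mul_toFn_mul_toFn {f g p : ScalarSeries} (hf : Summable fun k => ‖f k‖ ^ 2)
    (hg : Summable fun k => ‖g k‖ ^ 2) {S : Finset Freq} (hS : ∀ k ∉ S, p k = 0) :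
    Integrable (fun x => toFn f x * toFn p x * toFn g x) boxMeasure ∧
      ((2 * Real.pi : ℂ) ^ 3)⁻¹ * ∫ x, toFn f x * toFn p x * toFn g x ∂boxMeasure =
        ∑ m ∈ S, p m * ∑' l, f l * g (-m - l) := by
  have hF := isSumOf_toFn hf
  have hG := isSumOf_toFn hg
  have hint : ∀ m, Integrable (fun x => p m * (toFn f x * (character m x * toFn g x)))
      boxMeasure := fun m =>
    (hF.1.integrable_mul (q := 2) (hG.1.mul (memLp_character m ⊤))).const_mul _
  have hae : (fun x => toFn f x * toFn p x * toFn g x) =ᵐ[boxMeasure]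
      fun x => ∑ m ∈ S, p m * (toFn f x * (character m x * toFn g x)) := by
    filter_upwards [toFn_of_support hS] with x hx
    rw [hx, Finset.mul_sum, Finset.sum_mul]
    exact Finset.sum_congr rfl fun m _ => by ring
  refine ⟨(integrable_finsetSum S fun m _ => hint m).congr hae.symm, ?_⟩
  rw [integral_congr_ae hae, integral_finsetSum S fun m _ => hint m, Finset.mul_sum]
  refine Finset.sum_congr rfl fun m _ => ?_
  rw [integral_const_mul, ← (hF.hasSum_integral_triple hG m).tsum_eq, tsum_mul_left]
  have : (2 * Real.pi : ℂ) ^ 3 ≠ 0 := pow_ne_zero _ (by exact_mod_cast Real.two_pi_pos.ne')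
  field_simp

theorem summable_mul_sub {f g : ScalarSeries} (hf : Summable fun k => ‖f k‖ ^ 2)
    (hg : Summable fun k => ‖g k‖ ^ 2) (k : Freq) : Summable fun l => f l * g (k - l) := by
  have hg' : Summable fun l => ‖g (k - l)‖ ^ 2 := (Equiv.subLeft k).summable_iff.2 hg
  refine Summable.of_norm ?_
  simpa using (summable_mul_and_tsum_le (fun l => norm_nonneg (f l))
    (fun l => norm_nonneg (g (k - l))) hf hg').1

/-- The `k`-th Fourier coefficient of `-div (f u)`. -/
def fluxCoeff (u : VectorSeries) (f : ScalarSeries) (k : Freq) : ℂ :=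
  ∑' l, -Complex.I * (∑ j, (k j : ℂ) * u l j) * f (k - l)

theorem summable_component {u : VectorSeries} (hu : Summable fun k => ‖u k‖ ^ 2) (j : Fin 3) :
    Summable fun k => ‖component j u k‖ ^ 2 :=
  Summable.of_nonneg_of_le (fun _ => by positivity)
    (fun k => pow_le_pow_left₀ (norm_nonneg _) (PiLp.norm_apply_le (u k) j) 2) hu

theorem summable_flux {u : VectorSeries} {f : ScalarSeries} (hu : Summable fun k => ‖u k‖ ^ 2)
    (hf : Summable fun k => ‖f k‖ ^ 2) (k : Freq) :
    Summable fun l => -Complex.I * (∑ j, (k j : ℂ) * u l j) * f (k - l) := by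
  have : ∀ l, -Complex.I * (∑ j, (k j : ℂ) * u l j) * f (k - l) =
      ∑ j, -Complex.I * (k j : ℂ) * (component j u l * f (k - l)) := by
    intro l
    simp only [Finset.mul_sum, Finset.sum_mul, component]
    exact Finset.sum_congr rfl fun j _ => by ring
  simp_rw [this]
  exact summable_sum fun j _ => (summable_mul_sub (summable_component hu j) hf k).mul_left _

/-- Integration by parts in Fourier variables: the symbol i m_j of the derivative on φ is also the
symbol -i(-m)_j of the minus divergence, read at -m. -/
theorem sum_pderiv_mul_tsum {u : VectorSeries} {θ : ScalarSeries}
    (hu : Summable fun k => ‖u k‖ ^ 2) (hθ : Summable fun k => ‖θ k‖ ^ 2) (φ : ScalarSeries)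
    (m : Freq) :
    ∑ j, pderiv j φ m * ∑' l, component j u l * θ (-m - l) = φ m * fluxCoeff u θ (-m) := by
  have hs : ∀ j, Summable fun l => component j u l * θ (-m - l) := fun j =>
    summable_mul_sub (summable_component hu j) hθ (-m)
  simp_rw [← tsum_mul_left]
  rw [fluxCoeff, ← tsum_mul_left, ← Summable.tsum_finsetSum fun j _ => (hs j).mul_left _]
  refine tsum_congr fun l => ?_
  simp only [Finset.mul_sum, Finset.sum_mul, component, pderiv]
  exact Finset.sum_congr rfl fun j _ => by simp; ring

theorem transport_integral {u : VectorSeries} {φ θ : ScalarSeries}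
    (hu : Summable fun k => ‖u k‖ ^ 2) (hθ : Summable fun k => ‖θ k‖ ^ 2) {S : Finset Freq}
    (hS : ∀ k ∉ S, φ k = 0) :
    Integrable (fun x => (∑ j, toFn (component j u) x * toFn (pderiv j φ) x) * toFn θ x)
        boxMeasure ∧
      transportForm u φ θ = ∑ m ∈ S, φ m * fluxCoeff u θ (-m) := by
  have h := fun j => integral_toFn_mul_toFn_mul_toFn (summable_component hu j) hθ
    (p := pderiv j φ) (S := S) fun k hk => by simp [pderiv, hS k hk]
  have hi := integrable_finsetSum Finset.univ fun j _ => (h j).1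
  simp_rw [transportForm, Finset.sum_mul]
  refine ⟨hi, ?_⟩
  rw [integral_finsetSum _ fun j _ => (h j).1, Finset.mul_sum, Finset.sum_congr rfl fun j _ =>
    (h j).2, Finset.sum_comm]
  exact Finset.sum_congr rfl fun m _ => sum_pderiv_mul_tsum hu hθ φ m

theorem transportForm_eq {u : VectorSeries} {φ θ : ScalarSeries}
    (hu : Summable fun k => ‖u k‖ ^ 2) (hθ : Summable fun k => ‖θ k‖ ^ 2) {S : Finset Freq}
    (hS : ∀ k ∉ S, φ k = 0) :
    transportForm u φ θ = ∑ m ∈ S, φ m * fluxCoeff u θ (-m) :=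
  (transport_integral hu hθ hS).2

theorem trilinB_eq {u ψ v : VectorSeries} (hu : Summable fun k => ‖u k‖ ^ 2)
    (hv : Summable fun k => ‖v k‖ ^ 2) {S : Finset Freq} (hS : ∀ k ∉ S, ψ k = 0) :
    trilinB u ψ v = ∑ i, ∑ m ∈ S, ψ m i * fluxCoeff u (component i v) (-m) := by
  have h := fun i => transport_integral hu (summable_component hv i)
    (φ := component i ψ) (S := S) fun k hk => by simp [component, hS k hk]
  rw [trilinB, integral_finsetSum _ fun i _ => (h i).1, Finset.mul_sum]
  exact Finset.sum_congr rfl fun i _ => (h i).2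

/-! ### Two-mode test functions -/

/-- The real series `a e^{-ik·x} + conj a e^{ik·x}`. -/
def twoMode (k : Freq) (a : ℂ) : ScalarSeries :=
  fun m => if m = -k then a else if m = k then conj a else 0

theorem twoMode_of_notMem {k m : Freq} (a : ℂ) (hm : m ∉ ({k, -k} : Finset Freq)) :
    twoMode k a m = 0 := by
  simp only [Finset.mem_insert, Finset.mem_singleton, not_or] at hm
  simp [twoMode, hm.1, hm.2]

theorem neg_ne_self_of_ne_zero {k : Freq} (hk : k ≠ 0) : -k ≠ k := by
  intro h
  refine hk (funext fun i => ?_)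
  have := congrFun h i
  simp only [Pi.neg_apply] at this
  simp only [Pi.zero_apply]
  omega

theorem sum_twoMode {k : Freq} (hk : k ≠ 0) (a : ℂ) (X : ScalarSeries) :
    ∑ m ∈ ({k, -k} : Finset Freq), twoMode k a m * X (-m) = a * X k + conj a * X (-k) := by
  have h := neg_ne_self_of_ne_zero hk
  rw [Finset.sum_pair h.symm]
  simp [twoMode, h.symm]
  ring

theorem pairH_twoMode {k : Freq} (hk : k ≠ 0) (a : ℂ) (X : ScalarSeries) :
    pairH X (twoMode k a) = a * X k + conj a * X (-k) := by
  have h : ∑' m, twoMode k a m * X (-m) = ∑ m ∈ ({k, -k} : Finset Freq), twoMode k a m * X (-m) :=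
    tsum_eq_sum fun m hm => by rw [twoMode_of_notMem a hm, zero_mul]
  rw [pairH, ← sum_twoMode hk, ← h, ← (Equiv.neg Freq).tsum_eq]
  exact tsum_congr fun m => by simp [mul_comm]

theorem twoMode_zero {k : Freq} (hk : k ≠ 0) (a : ℂ) : twoMode k a 0 = 0 :=
  twoMode_of_notMem a (by simp [hk, hk.symm])

theorem twoMode_neg {k : Freq} (hk : k ≠ 0) (a : ℂ) (m : Freq) :
    twoMode k a (-m) = conj (twoMode k a m) := by
  have h := neg_ne_self_of_ne_zero hk
  rcases eq_or_ne m k with rfl | h1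
  · simp [twoMode, h.symm]
  rcases eq_or_ne m (-k) with rfl | h2
  · simp [twoMode, h.symm]
  · have h3 : -m ≠ k := fun h3 => h2 (by rw [← h3, neg_neg])
    rw [twoMode_of_notMem a (by simp [h1, h3]), twoMode_of_notMem a (by simp [h1, h2]), map_zero]

theorem twoMode_mem {k : Freq} (hk : k ≠ 0) (a : ℂ) (s : ℝ) : twoMode k a ∈ HSub s :=
  ⟨⟨twoMode_zero hk a, summable_of_ne_finset_zero (s := {k, -k}) fun m hm => by
    simp [twoMode_of_notMem a hm]⟩, twoMode_neg hk a⟩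

/-- The vector series `π (a e^{-ik·x} + conj a e^{ik·x})`, for `π ∈ ℝ³`. -/
def vecMode (k : Freq) (π : Fin 3 → ℝ) (a : ℂ) : VectorSeries :=
  fun m => WithLp.toLp 2 fun i => (π i : ℂ) * twoMode k a m

theorem vecMode_apply (k : Freq) (π : Fin 3 → ℝ) (a : ℂ) (m : Freq) (i : Fin 3) :
    vecMode k π a m i = π i * twoMode k a m := rfl

theorem vecMode_of_notMem {k m : Freq} (π : Fin 3 → ℝ) (a : ℂ)
    (hm : m ∉ ({k, -k} : Finset Freq)) : vecMode k π a m = 0 := by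
  ext i
  simp [vecMode_apply, twoMode_of_notMem a hm]

theorem vecMode_mem {k : Freq} (hk : k ≠ 0) {π : Fin 3 → ℝ} (hπ : ∑ i, π i * k i = 0) (a : ℂ)
    (s : ℝ) : vecMode k π a ∈ VSub s := by
  have hπ' : ∑ i, (π i : ℂ) * (k i : ℂ) = 0 := by exact_mod_cast congrArg Complex.ofReal hπ
  refine ⟨⟨vecMode_of_notMem π a (by simp [hk, hk.symm]),
    summable_of_ne_finset_zero (s := {k, -k}) fun m hm => by simp [vecMode_of_notMem π a hm]⟩,
    fun m i => by simp [vecMode_apply, twoMode_neg hk], fun m => ?_⟩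
  have h : ∀ i, vecMode k π a m i * (m i : ℂ) = twoMode k a m * ((π i : ℂ) * (m i : ℂ)) :=
    fun i => by rw [vecMode_apply]; ring
  simp_rw [h, ← Finset.mul_sum]
  rcases eq_or_ne m k with rfl | h1
  · rw [hπ', mul_zero]
  rcases eq_or_ne m (-k) with rfl | h2
  · simp [hπ']
  · rw [twoMode_of_notMem a (by simp [h1, h2]), zero_mul]

/-- The scalar series `π · v`. -/
def contract (π : Fin 3 → ℝ) (v : VectorSeries) : ScalarSeries := fun k => ∑ i, (π i : ℂ) * v k i

theorem pairV_vecMode (v : VectorSeries) (k : Freq) (π : Fin 3 → ℝ) (a : ℂ) :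
    pairV v (vecMode k π a) = pairH (contract π v) (twoMode k a) := by
  refine tsum_congr fun m => ?_
  rw [contract, Finset.sum_mul]
  exact Finset.sum_congr rfl fun i _ => by rw [vecMode_apply]; ring

theorem contract_timesE3 (π : Fin 3 → ℝ) (θ : ScalarSeries) (k : Freq) :
    contract π (timesE3 θ) k = π 2 * θ k := by
  simp [contract, timesE3, PiLp.single_apply]

theorem pairV_Lam_vecMode (β : ℝ) (v : VectorSeries) {k : Freq} (hk : k ≠ 0) (π : Fin 3 → ℝ)
    (a : ℂ) : pairV (Lam β v) (Lam β (vecMode k π a)) =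
      pairH (fun m => ((freqNorm m ^ (2 * β) : ℝ) : ℂ) * contract π v m) (twoMode k a) := by
  refine tsum_congr fun m => ?_
  rcases eq_or_ne m 0 with rfl | hm
  · simp [Lam, vecMode_apply, twoMode_zero hk]
  have h : freqNorm m ^ (2 * β) = freqNorm m ^ β * freqNorm m ^ β := by
    rw [← Real.rpow_add (freqNorm_pos hm)]; ring_nf
  simp only [contract, h, Finset.mul_sum, Finset.sum_mul]
  refine Finset.sum_congr rfl fun i _ => ?_
  simp only [Lam, PiLp.smul_apply, vecMode_apply, freqNorm_neg, Complex.real_smul]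
  push_cast
  ring

theorem transportForm_twoMode {u : VectorSeries} {θ : ScalarSeries}
    (hu : Summable fun k => ‖u k‖ ^ 2) (hθ : Summable fun k => ‖θ k‖ ^ 2) {k : Freq} (hk : k ≠ 0)
    (a : ℂ) : transportForm u (twoMode k a) θ =
      a * fluxCoeff u θ k + conj a * fluxCoeff u θ (-k) := by
  rw [transportForm_eq hu hθ fun m hm => twoMode_of_notMem a hm,
    sum_twoMode hk a (fluxCoeff u θ)]

theorem trilinB_vecMode {u v : VectorSeries} (hu : Summable fun k => ‖u k‖ ^ 2)
    (hv : Summable fun k => ‖v k‖ ^ 2) {k : Freq} (hk : k ≠ 0) (π : Fin 3 → ℝ) (a : ℂ) :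
    trilinB u (vecMode k π a) v = a * (∑ i, π i * fluxCoeff u (component i v) k) +
      conj a * ∑ i, π i * fluxCoeff u (component i v) (-k) := by
  rw [trilinB_eq hu hv fun m hm => vecMode_of_notMem π a hm,
    ← sum_twoMode hk a fun m => ∑ i, π i * fluxCoeff u (component i v) m, Finset.sum_comm]
  refine Finset.sum_congr rfl fun m _ => ?_
  rw [Finset.mul_sum]
  exact Finset.sum_congr rfl fun i _ => by rw [vecMode_apply]; ring

/-- Real test functions couple the frequencies k and -k; the amplitudes 1 and i decouple them. -/
theorem eq_zero_of_forall_twoMode {X Y : ℂ} (h : ∀ a : ℂ, a * X + conj a * Y = 0) : X = 0 := by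
  have h1 := h 1
  have h2 := h Complex.I
  simp only [map_one, one_mul, Complex.conj_I] at h1 h2
  have h3 : Complex.I * (X - Y) = 0 := by linear_combination h2
  have h4 : X - Y = 0 := (mul_eq_zero.1 h3).resolve_left Complex.I_ne_zero
  linear_combination (h1 + h4) / 2

/-! ### Bounds for Fourier coefficients -/

theorem norm_sq_mul_rpow {E : Type*} [NormedAddCommGroup E] [NormedSpace ℝ E] (s : ℝ)
    (f : Freq → E) (k : Freq) : ‖Lam s f k‖ ^ 2 = ‖f k‖ ^ 2 * freqNorm k ^ (2 * s) := by
  have h0 := freqNorm_nonneg k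
  rw [Lam, norm_smul, Real.norm_of_nonneg (Real.rpow_nonneg h0 s), mul_pow, mul_comm, mul_comm 2 s,
    Real.rpow_mul h0, Real.rpow_two]

theorem VSpace.hasSum_norm {s : ℝ} (w : VSpace s) :
    HasSum (fun k => ‖w.coeff k‖ ^ 2 * freqNorm k ^ (2 * s)) (‖w‖ ^ 2) := by
  have h := lp.hasSum_norm (p := 2) (by norm_num) (VSpace.toL2 s w)
  simp only [ENNReal.toReal_ofNat, Real.rpow_two] at h
  exact h.congr_fun fun k => (norm_sq_mul_rpow s w.coeff k).symm

theorem HSpace.hasSum_norm {s : ℝ} (w : HSpace s) :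
    HasSum (fun k => ‖w.coeff k‖ ^ 2 * freqNorm k ^ (2 * s)) (‖w‖ ^ 2) := by
  have h := lp.hasSum_norm (p := 2) (by norm_num) (HSpace.toL2 s w)
  simp only [ENNReal.toReal_ofNat, Real.rpow_two] at h
  exact h.congr_fun fun k => (norm_sq_mul_rpow s w.coeff k).symm

theorem norm_le_of_tsum_le {E : Type*} [NormedAddCommGroup E] {f : Freq → E} (f0 : f 0 = 0)
    {s N : ℝ} (hN : 0 ≤ N)
    (hs : Summable fun k => ‖f k‖ ^ 2 * freqNorm k ^ (2 * s))
    (h : ∑' k, ‖f k‖ ^ 2 * freqNorm k ^ (2 * s) ≤ N ^ 2) (k : Freq) : ‖f k‖ ≤ N * freqNorm k ^ (-s) := by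
  rcases eq_or_ne k 0 with rfl | hk
  · rw [f0, norm_zero]
    exact mul_nonneg hN (Real.rpow_nonneg (freqNorm_nonneg _) _)
  have hp := freqNorm_pos hk
  have h1 : ‖f k‖ ^ 2 * freqNorm k ^ (2 * s) ≤ N ^ 2 :=
    (hs.le_tsum k fun m _ =>
      mul_nonneg (sq_nonneg _) (Real.rpow_nonneg (freqNorm_nonneg m) _)).trans h
  have h2 : freqNorm k ^ (2 * s) = (freqNorm k ^ s) ^ 2 := by
    rw [mul_comm, Real.rpow_mul hp.le, Real.rpow_two]
  rw [h2, ← mul_pow] at h1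
  have h3 := (pow_le_pow_iff_left₀ (by positivity) hN two_ne_zero).1 h1
  rw [Real.rpow_neg hp.le, ← div_eq_mul_inv, le_div_iff₀ (Real.rpow_pos_of_pos hp s)]
  exact h3

theorem VSpace.norm_coeff_le {s : ℝ} (w : VSpace s) (k : Freq) :
    ‖w.coeff k‖ ≤ ‖w‖ * freqNorm k ^ (-s) :=
  norm_le_of_tsum_le w.2.1.1 (norm_nonneg w) w.hasSum_norm.summable w.hasSum_norm.tsum_eq.le k

theorem HSpace.norm_coeff_le {s : ℝ} (w : HSpace s) (k : Freq) :
    ‖w.coeff k‖ ≤ ‖w‖ * freqNorm k ^ (-s) :=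
  norm_le_of_tsum_le w.2.1.1 (norm_nonneg w) w.hasSum_norm.summable w.hasSum_norm.tsum_eq.le k

theorem VSpace.continuous_coeff {s : ℝ} (k : Freq) :
    Continuous fun w : VSpace s => w.coeff k := by
  let L : VSpace s →+ EuclideanSpace ℂ (Fin 3) :=
    { toFun := fun w => w.coeff k, map_zero' := rfl, map_add' := fun _ _ => rfl }
  exact AddMonoidHomClass.continuous_of_bound L (freqNorm k ^ (-s)) fun w =>
    (w.norm_coeff_le k).trans_eq (mul_comm _ _)

theorem HSpace.continuous_coeff {s : ℝ} (k : Freq) :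
    Continuous fun w : HSpace s => w.coeff k := by
  let L : HSpace s →+ ℂ :=
    { toFun := fun w => w.coeff k, map_zero' := rfl, map_add' := fun _ _ => rfl }
  exact AddMonoidHomClass.continuous_of_bound L (freqNorm k ^ (-s)) fun w =>
    (w.norm_coeff_le k).trans_eq (mul_comm _ _)

/-! ### Curves of series, continuous in time -/

/-- `v(t) ∈ V^r` and `θ(t) ∈ H^q` have norms at most `M` and continuous coefficients. -/
structure RegularCurve (r q T M : ℝ) (v : ℝ → VectorSeries) (θ : ℝ → ScalarSeries) : Prop where
  bound_nonneg : 0 ≤ M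
  v_mem : ∀ t ∈ Icc 0 T, v t ∈ VSub r
  θ_mem : ∀ t ∈ Icc 0 T, θ t ∈ HSub q
  v_cont : ∀ k, ContinuousOn (fun t => v t k) (Icc 0 T)
  θ_cont : ∀ k, ContinuousOn (fun t => θ t k) (Icc 0 T)
  v_le : ∀ t ∈ Icc 0 T, ∑' k, ‖v t k‖ ^ 2 * freqNorm k ^ (2 * r) ≤ M ^ 2
  θ_le : ∀ t ∈ Icc 0 T, ∑' k, ‖θ t k‖ ^ 2 * freqNorm k ^ (2 * q) ≤ M ^ 2

/-- Compactness of [0, T] turns strong continuity into a uniform norm bound. That bound and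
continuity of each coefficient are all that the later arguments take from it. -/
theorem exists_regularCurve {r q T : ℝ} {v : ℝ → VectorSeries} {θ : ℝ → ScalarSeries}
    (hv : MemC (VSpace.coeff (s := r)) T v) (hθ : MemC (HSpace.coeff (s := q)) T θ) :
    ∃ M, RegularCurve r q T M v θ := by
  obtain ⟨w, hw, hwv⟩ := hv
  obtain ⟨η, hη, hηθ⟩ := hθ
  obtain ⟨M₁, hM₁⟩ := isCompact_Icc.exists_bound_of_continuousOn hw
  obtain ⟨M₂, hM₂⟩ := isCompact_Icc.exists_bound_of_continuousOn hη
  refine ⟨max 0 (max M₁ M₂), le_max_left _ _, fun t ht => hwv t ht ▸ (w t).2,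
    fun t ht => hηθ t ht ▸ (η t).2, fun k => ?_, fun k => ?_, fun t ht => ?_, fun t ht => ?_⟩
  · exact ((VSpace.continuous_coeff k).comp_continuousOn hw).congr
      fun t ht => by simp [← hwv t ht]
  · exact ((HSpace.continuous_coeff k).comp_continuousOn hη).congr
      fun t ht => by simp [← hηθ t ht]
  · rw [← hwv t ht, (w t).hasSum_norm.tsum_eq]
    exact pow_le_pow_left₀ (norm_nonneg _)
      ((hM₁ t ht).trans ((le_max_left _ _).trans (le_max_right _ _))) 2
  · rw [← hηθ t ht, (η t).hasSum_norm.tsum_eq]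
    exact pow_le_pow_left₀ (norm_nonneg _)
      ((hM₂ t ht).trans ((le_max_right _ _).trans (le_max_right _ _))) 2

theorem MemC.sub {X S : Type*} [NormedAddCommGroup X] [AddGroup S] {c : X → S}
    (hc : ∀ x y, c (x - y) = c x - c y) {T : ℝ} {v v' : ℝ → S} (h : MemC c T v)
    (h' : MemC c T v') : MemC c T fun t => v t - v' t := by
  obtain ⟨w, hw, hwv⟩ := h
  obtain ⟨w', hw', hwv'⟩ := h'
  exact ⟨fun t => w t - w' t, hw.sub hw', fun t ht => by rw [hc, hwv t ht, hwv' t ht]⟩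

theorem norm_dot_le (x : Fin 3 → ℂ) {K : ℝ} (hx : ∀ i, ‖x i‖ ≤ K)
    (w : EuclideanSpace ℂ (Fin 3)) : ‖∑ i, x i * w i‖ ≤ 3 * K * ‖w‖ := by
  have hK : 0 ≤ K := (norm_nonneg _).trans (hx 0)
  calc ‖∑ i, x i * w i‖ ≤ ∑ i : Fin 3, K * ‖w‖ := norm_sum_le_of_le _ fun i _ => by
        rw [norm_mul]
        exact mul_le_mul (hx i) (PiLp.norm_apply_le w i) (norm_nonneg _) hK
    _ = 3 * K * ‖w‖ := by simp; ring

theorem norm_freq_le (k : Freq) (i : Fin 3) : ‖(k i : ℂ)‖ ≤ freqNorm k := by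
  simpa using abs_le_freqNorm k i

theorem Lam_summable {E : Type*} [NormedAddCommGroup E] [NormedSpace ℝ E] {f : Freq → E}
    (f0 : f 0 = 0) {s p : ℝ} (hsp : p ≤ s)
    (hs : Summable fun k => ‖f k‖ ^ 2 * freqNorm k ^ (2 * s)) :
    (Summable fun k => ‖f k‖ ^ 2 * freqNorm k ^ (2 * p)) ∧
      ∑' k, ‖f k‖ ^ 2 * freqNorm k ^ (2 * p) ≤ ∑' k, ‖f k‖ ^ 2 * freqNorm k ^ (2 * s) := by
  have hle : ∀ k, ‖f k‖ ^ 2 * freqNorm k ^ (2 * p) ≤ ‖f k‖ ^ 2 * freqNorm k ^ (2 * s) := by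
    intro k
    rcases eq_or_ne k 0 with rfl | hk
    · simp [f0]
    · exact mul_le_mul_of_nonneg_left
        (Real.rpow_le_rpow_of_exponent_le (one_le_freqNorm hk) (by linarith)) (sq_nonneg _)
  have h := Summable.of_nonneg_of_le
    (fun k => mul_nonneg (sq_nonneg _) (Real.rpow_nonneg (freqNorm_nonneg k) _)) hle hs
  exact ⟨h, h.tsum_le_tsum hle hs⟩

theorem summable_norm_sq {E : Type*} [NormedAddCommGroup E] [NormedSpace ℝ E] {f : Freq → E}
    (f0 : f 0 = 0) {s : ℝ} (hs0 : 0 ≤ s)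
    (hs : Summable fun k => ‖f k‖ ^ 2 * freqNorm k ^ (2 * s)) :
    Summable fun k => ‖f k‖ ^ 2 := by
  simpa using (Lam_summable f0 hs0 hs).1

theorem norm_Lam (s : ℝ) {E : Type*} [NormedAddCommGroup E] [NormedSpace ℝ E] (f : Freq → E)
    (k : Freq) : ‖Lam s f k‖ = freqNorm k ^ s * ‖f k‖ := by
  rw [Lam, norm_smul, Real.norm_of_nonneg (Real.rpow_nonneg (freqNorm_nonneg k) s)]

theorem Lam_apply_zero (s : ℝ) {E : Type*} [NormedAddCommGroup E] [NormedSpace ℝ E] {f : Freq → E}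
    (f0 : f 0 = 0) : Lam s f 0 = 0 := by simp [Lam, f0]

theorem norm_sq_Lam_mul {E : Type*} [NormedAddCommGroup E] [NormedSpace ℝ E] {f : Freq → E}
    (f0 : f 0 = 0) (s p : ℝ) (k : Freq) :
    ‖Lam s f k‖ ^ 2 * freqNorm k ^ (2 * p) = ‖f k‖ ^ 2 * freqNorm k ^ (2 * (s + p)) := by
  rcases eq_or_ne k 0 with rfl | hk
  · simp [Lam, f0]
  · rw [norm_sq_mul_rpow, mul_assoc, ← Real.rpow_add (freqNorm_pos hk), mul_add]

/-- Weierstrass test for the flux: its coefficients depend continuously on time. -/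
theorem continuousOn_fluxCoeff {T s p M N : ℝ} {u : ℝ → VectorSeries} {f : ℝ → ScalarSeries}
    (hs : 0 ≤ s) (hp : 0 ≤ p) (hsp : 3 < s + p) (hM : 0 ≤ M) (hN : 0 ≤ N)
    (u0 : ∀ t ∈ Icc 0 T, u t 0 = 0) (f0 : ∀ t ∈ Icc 0 T, f t 0 = 0)
    (hu : ∀ t ∈ Icc 0 T, ∀ k, ‖u t k‖ ≤ M * freqNorm k ^ (-s))
    (hf : ∀ t ∈ Icc 0 T, ∀ k, ‖f t k‖ ≤ N * freqNorm k ^ (-p))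
    (hu' : ∀ k, ContinuousOn (fun t => u t k) (Icc 0 T))
    (hf' : ∀ k, ContinuousOn (fun t => f t k) (Icc 0 T)) (k : Freq) :
    ContinuousOn (fun t => fluxCoeff (u t) (f t) k) (Icc 0 T) := by
  have hn : ∀ (k : Freq) (s : ℝ), 0 ≤ freqNorm k ^ s :=
    fun k s => Real.rpow_nonneg (freqNorm_nonneg k) _
  have hL : Summable fun l : Freq => freqNorm l ^ (-(s + p)) :=
    summable_freqNorm_rpow (by linarith)
  have hmaj : Summable fun l : Freq => 3 * freqNorm k * M * N *
      (freqNorm l ^ (-(s + p)) + freqNorm (k - l) ^ (-(s + p))) :=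
    (hL.add ((Equiv.subLeft k).summable_iff.2 hL)).mul_left _
  refine continuousOn_tsum (fun l => ?_) hmaj fun l t ht => ?_
  · refine ContinuousOn.mul (continuousOn_const.mul ?_) (hf' _)
    refine continuousOn_finsetSum _ fun j _ => continuousOn_const.mul ?_
    exact ((EuclideanSpace.proj (𝕜 := ℂ) j).continuous.comp_continuousOn (hu' l))
  · have hR : 0 ≤ 3 * freqNorm k * M * N *
        (freqNorm l ^ (-(s + p)) + freqNorm (k - l) ^ (-(s + p))) := by
      have := hn l (-(s + p)); have := hn (k - l) (-(s + p)); have := freqNorm_nonneg k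
      positivity
    rcases eq_or_ne l 0 with rfl | hl
    · simpa [u0 t ht] using hR
    rcases eq_or_ne (k - l) 0 with hm | hm
    · simpa [hm, f0 t ht] using hR
    have pl := freqNorm_pos hl
    have pm := freqNorm_pos hm
    -- Replacing the larger frequency by the smaller one increases its negative power, so one pure
    -- power of order -(s + p) dominates; it is summable since s + p > 3.
    have h1 : freqNorm l ^ (-s) * freqNorm (k - l) ^ (-p) ≤
        freqNorm l ^ (-(s + p)) + freqNorm (k - l) ^ (-(s + p)) := by
      rw [neg_add, Real.rpow_add pl, Real.rpow_add pm]
      rcases le_total (freqNorm l) (freqNorm (k - l)) with hle | hle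
      · refine le_trans (mul_le_mul_of_nonneg_left ?_ (hn _ _))
          (le_add_of_nonneg_right (mul_nonneg (hn _ _) (hn _ _)))
        exact Real.rpow_le_rpow_of_nonpos pl hle (by linarith)
      · refine le_trans (mul_le_mul_of_nonneg_right ?_ (hn _ _))
          (le_add_of_nonneg_left (mul_nonneg (hn _ _) (hn _ _)))
        exact Real.rpow_le_rpow_of_nonpos pm hle (by linarith)
    have h2 := norm_dot_le (fun j => (k j : ℂ)) (norm_freq_le k) (u t l)
    have hk0 := freqNorm_nonneg k
    calc ‖-Complex.I * (∑ j, (k j : ℂ) * u t l j) * f t (k - l)‖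
        = ‖∑ j, (k j : ℂ) * u t l j‖ * ‖f t (k - l)‖ := by simp
      _ ≤ (3 * freqNorm k * (M * freqNorm l ^ (-s))) * (N * freqNorm (k - l) ^ (-p)) :=
          mul_le_mul (h2.trans (mul_le_mul_of_nonneg_left (hu t ht l) (by positivity)))
            (hf t ht _) (norm_nonneg _) (mul_nonneg (by positivity) (mul_nonneg hM (hn _ _)))
      _ = 3 * freqNorm k * M * N * (freqNorm l ^ (-s) * freqNorm (k - l) ^ (-p)) := by ring
      _ ≤ _ := mul_le_mul_of_nonneg_left h1 (by positivity)

/-! ### Coefficient bounds and time continuity along a regular curve -/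

namespace RegularCurve

variable {r q T M : ℝ} {v : ℝ → VectorSeries} {θ : ℝ → ScalarSeries}

theorem v_zero (h : RegularCurve r q T M v θ) {t : ℝ} (ht : t ∈ Icc 0 T) : v t 0 = 0 :=
  (h.v_mem t ht).1.1

theorem θ_zero (h : RegularCurve r q T M v θ) {t : ℝ} (ht : t ∈ Icc 0 T) : θ t 0 = 0 :=
  (h.θ_mem t ht).1.1

theorem norm_v_le (h : RegularCurve r q T M v θ) {t : ℝ} (ht : t ∈ Icc 0 T) (k : Freq) :
    ‖v t k‖ ≤ M * freqNorm k ^ (-r) :=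
  norm_le_of_tsum_le (h.v_zero ht) h.bound_nonneg (h.v_mem t ht).1.2 (h.v_le t ht) k

theorem norm_θ_le (h : RegularCurve r q T M v θ) {t : ℝ} (ht : t ∈ Icc 0 T) (k : Freq) :
    ‖θ t k‖ ≤ M * freqNorm k ^ (-q) :=
  norm_le_of_tsum_le (h.θ_zero ht) h.bound_nonneg (h.θ_mem t ht).1.2 (h.θ_le t ht) k

theorem norm_u_le (h : RegularCurve r q T M v θ) (α : ℝ) {t : ℝ} (ht : t ∈ Icc 0 T) (k : Freq) :
    ‖Lam (-2 * α) (v t) k‖ ≤ M * freqNorm k ^ (-(r + 2 * α)) := by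
  rcases eq_or_ne k 0 with rfl | hk
  · rw [Lam_apply_zero _ (h.v_zero ht), norm_zero]
    exact mul_nonneg h.bound_nonneg (Real.rpow_nonneg (freqNorm_nonneg _) _)
  · rw [norm_Lam]
    have hp := freqNorm_pos hk
    calc _ ≤ freqNorm k ^ (-2 * α) * (M * freqNorm k ^ (-r)) :=
          mul_le_mul_of_nonneg_left (h.norm_v_le ht k) (Real.rpow_nonneg hp.le _)
      _ = M * (freqNorm k ^ (-2 * α) * freqNorm k ^ (-r)) := by ring
      _ = _ := by rw [← Real.rpow_add hp]; congr 2; ring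

theorem u_cont (h : RegularCurve r q T M v θ) (α : ℝ) (k : Freq) :
    ContinuousOn (fun t => Lam (-2 * α) (v t) k) (Icc 0 T) :=
  (h.v_cont k).const_smul (freqNorm k ^ (-2 * α))

theorem component_cont (h : RegularCurve r q T M v θ) (i : Fin 3) (k : Freq) :
    ContinuousOn (fun t => component i (v t) k) (Icc 0 T) :=
  (EuclideanSpace.proj (𝕜 := ℂ) i).continuous.comp_continuousOn (h.v_cont k)

theorem continuousOn_flux_θ (h : RegularCurve r q T M v θ) {α : ℝ} (hr : 0 ≤ r) (hα : 0 ≤ α)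
    (hq : 0 ≤ q) (hrq : 3 < r + 2 * α + q) (k : Freq) :
    ContinuousOn (fun t => fluxCoeff (Lam (-2 * α) (v t)) (θ t) k) (Icc 0 T) :=
  continuousOn_fluxCoeff (by linarith) hq hrq h.bound_nonneg h.bound_nonneg
    (fun t ht => Lam_apply_zero _ (h.v_zero ht)) (fun t ht => h.θ_zero ht)
    (fun t ht => h.norm_u_le α ht) (fun t ht => h.norm_θ_le ht) (h.u_cont α) h.θ_cont k

theorem continuousOn_flux_v (h : RegularCurve r q T M v θ) {α : ℝ} (hr : 0 ≤ r) (hα : 0 ≤ α)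
    (hrr : 3 < r + 2 * α + r) (i : Fin 3) (k : Freq) :
    ContinuousOn (fun t => fluxCoeff (Lam (-2 * α) (v t)) (component i (v t)) k) (Icc 0 T) :=
  continuousOn_fluxCoeff (by linarith) hr hrr h.bound_nonneg h.bound_nonneg
    (fun t ht => Lam_apply_zero _ (h.v_zero ht)) (fun t ht => by simp [h.v_zero ht])
    (fun t ht => h.norm_u_le α ht)
    (fun t ht k => (PiLp.norm_apply_le _ _).trans (h.norm_v_le ht k)) (h.u_cont α)
    (h.component_cont i) k

theorem summable_v (h : RegularCurve r q T M v θ) (hr : 0 ≤ r) {t : ℝ} (ht : t ∈ Icc 0 T) :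
    Summable fun k => ‖v t k‖ ^ 2 :=
  summable_norm_sq (h.v_zero ht) hr (h.v_mem t ht).1.2

theorem summable_θ (h : RegularCurve r q T M v θ) (hq : 0 ≤ q) {t : ℝ} (ht : t ∈ Icc 0 T) :
    Summable fun k => ‖θ t k‖ ^ 2 :=
  summable_norm_sq (h.θ_zero ht) hq (h.θ_mem t ht).1.2

theorem summable_u (h : RegularCurve r q T M v θ) {α : ℝ} (hr : 0 ≤ r) (hα : 0 ≤ α) {t : ℝ}
    (ht : t ∈ Icc 0 T) : Summable fun k => ‖Lam (-2 * α) (v t) k‖ ^ 2 := by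
  have h1 := (Lam_summable (p := -2 * α) (h.v_zero ht) (by linarith) (h.v_mem t ht).1.2).1
  exact h1.congr fun k => (norm_sq_mul_rpow _ _ k).symm

end RegularCurve

/-! ### The equations for the Fourier coefficients -/

theorem intervalIntegrable_of_continuousOn_Icc {E : Type*} [NormedAddCommGroup E] {T t : ℝ}
    (ht : t ∈ Icc 0 T) {f : ℝ → E} (hf : ContinuousOn f (Icc 0 T)) :
    IntervalIntegrable f volume 0 t :=
  ContinuousOn.intervalIntegrable (hf.mono (by
    rw [uIcc_of_le ht.1]; exact Icc_subset_Icc_right ht.2))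

theorem integral_congr_of_Icc {E : Type*} [NormedAddCommGroup E] [NormedSpace ℝ E] {T t : ℝ}
    (ht : t ∈ Icc 0 T) {f g : ℝ → E} (hfg : ∀ s ∈ Icc 0 T, f s = g s) :
    ∫ s in (0 : ℝ)..t, f s = ∫ s in (0 : ℝ)..t, g s :=
  intervalIntegral.integral_congr fun s hs => hfg s (by
    rw [uIcc_of_le ht.1] at hs; exact Icc_subset_Icc_right ht.2 hs)

theorem integral_twoMode {T t : ℝ} (ht : t ∈ Icc 0 T) {X Y : ℝ → ℂ}
    (hX : ContinuousOn X (Icc 0 T)) (hY : ContinuousOn Y (Icc 0 T)) (a : ℂ) :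
    ∫ s in (0 : ℝ)..t, (a * X s + conj a * Y s) =
      a * (∫ s in (0 : ℝ)..t, X s) + conj a * ∫ s in (0 : ℝ)..t, Y s := by
  rw [intervalIntegral.integral_add
    ((intervalIntegrable_of_continuousOn_Icc ht hX).const_mul a)
    ((intervalIntegrable_of_continuousOn_Icc ht hY).const_mul _),
    intervalIntegral.integral_const_mul, intervalIntegral.integral_const_mul]

theorem RegularCurve.continuousOn_contract {r q T M : ℝ} {v : ℝ → VectorSeries}
    {θ : ℝ → ScalarSeries} (h : RegularCurve r q T M v θ) (π : Fin 3 → ℝ) (k : Freq) :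
    ContinuousOn (fun s => contract π (v s) k) (Icc 0 T) :=
  continuousOn_finsetSum _ fun i _ => continuousOn_const.mul (h.component_cont i k)

section Modes

variable {α β ν r q T M : ℝ} {v₀ : VectorSeries} {θ₀ : ScalarSeries} {v : ℝ → VectorSeries}
  {θ : ℝ → ScalarSeries}

/-- Tested with two modes of arbitrary amplitude. Continuity of the flux in time is what permits
splitting the time integral into its k and -k parts. -/
theorem IsWeakSolution.temperature_mode (h : IsWeakSolution α β ν T v₀ θ₀ v θ)
    (hc : RegularCurve r q T M v θ) (hr : 0 ≤ r) (hα : 0 ≤ α) (hq : 0 ≤ q)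
    (hrq : 3 < r + 2 * α + q) {k : Freq} (hk : k ≠ 0) {t : ℝ} (ht : t ∈ Icc 0 T) :
    θ t k = θ₀ k + ∫ s in (0 : ℝ)..t, fluxCoeff (Lam (-2 * α) (v s)) (θ s) k := by
  have key : θ t k - (∫ s in (0 : ℝ)..t, fluxCoeff (Lam (-2 * α) (v s)) (θ s) k) - θ₀ k = 0 := by
    refine eq_zero_of_forall_twoMode (Y := θ t (-k) -
      (∫ s in (0 : ℝ)..t, fluxCoeff (Lam (-2 * α) (v s)) (θ s) (-k)) - θ₀ (-k)) fun a => ?_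
    have e := h.temperature ⟨twoMode k a, twoMode_mem hk a _⟩ t ht
    simp only [HSpace.coeff] at e
    rw [pairH_twoMode hk, pairH_twoMode hk, integral_congr_of_Icc ht fun s hs =>
      transportForm_twoMode (hc.summable_u hr hα hs) (hc.summable_θ hq hs) hk a,
      integral_twoMode ht (hc.continuousOn_flux_θ hr hα hq hrq k)
        (hc.continuousOn_flux_θ hr hα hq hrq (-k))] at e
    linear_combination e
  linear_combination key

/-- The `k`-th Fourier coefficient of `-(u · ∇)vᵢ - ν Λ^{2β} vᵢ + (θ e₃)ᵢ`. -/
def velocityForce (α β ν : ℝ) (v : VectorSeries) (θ : ScalarSeries) (k : Freq) (i : Fin 3) : ℂ :=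
  fluxCoeff (Lam (-2 * α) v) (component i v) k - ν * ((freqNorm k ^ (2 * β) : ℝ) : ℂ) * v k i +
    if i = 2 then θ k else 0

theorem RegularCurve.continuousOn_velocityForce (hc : RegularCurve r q T M v θ) (hr : 0 ≤ r)
    (hα : 0 ≤ α) (hrr : 3 < r + 2 * α + r) (k : Freq) (i : Fin 3) :
    ContinuousOn (fun s => velocityForce α β ν (v s) (θ s) k i) (Icc 0 T) := by
  refine ((hc.continuousOn_flux_v hr hα hrr i k).sub
    (continuousOn_const.mul (hc.component_cont i k))).add ?_
  split_ifs
  · exact hc.θ_cont k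
  · exact continuousOn_const

theorem sum_mul_velocityForce (π : Fin 3 → ℝ) (w : VectorSeries) (η : ScalarSeries) (m : Freq) :
    ∑ i, (π i : ℂ) * velocityForce α β ν w η m i =
      (∑ i, (π i : ℂ) * fluxCoeff (Lam (-2 * α) w) (component i w) m) -
        ν * (((freqNorm m ^ (2 * β) : ℝ) : ℂ) * contract π w m) + π 2 * η m := by
  simp only [velocityForce, contract, Finset.mul_sum]
  have h2 : (π 2 : ℂ) * η m = ∑ i, (π i : ℂ) * if i = 2 then η m else 0 := by simp
  rw [h2, ← Finset.sum_sub_distrib, ← Finset.sum_add_distrib]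
  exact Finset.sum_congr rfl fun i _ => by ring

/-- Divergence-free test functions at frequency k have polarisations orthogonal to k, so the weak
formulation only sees such contractions of the equation and no pressure appears. -/
theorem IsWeakSolution.velocity_mode (h : IsWeakSolution α β ν T v₀ θ₀ v θ)
    (hc : RegularCurve r q T M v θ) (hr : 0 ≤ r) (hα : 0 ≤ α)
    (hrr : 3 < r + 2 * α + r) {k : Freq} (hk : k ≠ 0) {π : Fin 3 → ℝ}
    (hπ : ∑ i, π i * k i = 0) {t : ℝ} (ht : t ∈ Icc 0 T) :
    contract π (v t) k = contract π v₀ k +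
      ∫ s in (0 : ℝ)..t, ∑ i, (π i : ℂ) * velocityForce α β ν (v s) (θ s) k i := by
  let A : Freq → ℝ → ℂ := fun m s =>
    ∑ i, (π i : ℂ) * fluxCoeff (Lam (-2 * α) (v s)) (component i (v s)) m
  let B : Freq → ℝ → ℂ := fun m s => ((freqNorm m ^ (2 * β) : ℝ) : ℂ) * contract π (v s) m
  let C : Freq → ℝ → ℂ := fun m s => (π 2 : ℂ) * θ s m
  have hA : ∀ m, ContinuousOn (A m) (Icc 0 T) := fun m =>
    continuousOn_finsetSum _ fun i _ => continuousOn_const.mul (hc.continuousOn_flux_v hr hα hrr i m)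
  have hB : ∀ m, ContinuousOn (B m) (Icc 0 T) := fun m =>
    continuousOn_const.mul (hc.continuousOn_contract π m)
  have hC : ∀ m, ContinuousOn (C m) (Icc 0 T) := fun m => continuousOn_const.mul (hc.θ_cont m)
  -- The residual of the contracted equation at frequency m; the weak formulation reads a X(k) +
  -- conj a X(-k) = 0.
  let X : Freq → ℂ := fun m => contract π (v t) m - (∫ s in (0 : ℝ)..t, A m s) +
    ν * (∫ s in (0 : ℝ)..t, B m s) - contract π v₀ m - ∫ s in (0 : ℝ)..t, C m s
  have key : X k = 0 := by
    refine eq_zero_of_forall_twoMode (Y := X (-k)) fun a => ?_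
    have e := h.velocity ⟨vecMode k π a, vecMode_mem hk hπ a _⟩ t ht
    simp only [VSpace.coeff, pairV_Lam_vecMode β _ hk, pairV_vecMode,
      pairH_twoMode hk, contract_timesE3] at e
    rw [integral_congr_of_Icc ht fun s hs =>
      trilinB_vecMode (hc.summable_u hr hα hs) (hc.summable_v hr hs) hk π a,
      integral_twoMode ht (hA k) (hA (-k)), integral_twoMode ht (hB k) (hB (-k)),
      integral_twoMode ht (hC k) (hC (-k))] at e
    simp only [X]
    linear_combination e
  have hsum : ∫ s in (0 : ℝ)..t, ∑ i, (π i : ℂ) * velocityForce α β ν (v s) (θ s) k i =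
      (∫ s in (0 : ℝ)..t, A k s) - ν * (∫ s in (0 : ℝ)..t, B k s) + ∫ s in (0 : ℝ)..t, C k s := by
    have iA := intervalIntegrable_of_continuousOn_Icc ht (hA k)
    have iB := (intervalIntegrable_of_continuousOn_Icc ht (hB k)).const_mul (ν : ℂ)
    have iC := intervalIntegrable_of_continuousOn_Icc ht (hC k)
    rw [← intervalIntegral.integral_const_mul, ← intervalIntegral.integral_sub iA iB,
      ← intervalIntegral.integral_add (iA.sub iB) iC]
    exact integral_congr_of_Icc ht fun s _ => sum_mul_velocityForce π (v s) (θ s) k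
  rw [hsum]
  simp only [X] at key
  linear_combination key

/-- The `i`-th row of the projection of `ℝ³` onto the plane orthogonal to `k`. -/
def lerayRow (k : Freq) (i : Fin 3) : Fin 3 → ℝ :=
  fun j => (if j = i then 1 else 0) - k i * k j / freqNorm k ^ 2

theorem sum_lerayRow_mul {k : Freq} (hk : k ≠ 0) (i : Fin 3) : ∑ j, lerayRow k i j * k j = 0 := by
  have hp := (freqNorm_pos hk).ne'
  have h : ∀ j, lerayRow k i j * k j =
      (if j = i then (k j : ℝ) else 0) - k i / freqNorm k ^ 2 * (k j : ℝ) ^ 2 := by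
    intro j
    simp only [lerayRow]
    split_ifs <;> ring
  simp_rw [h]
  rw [Finset.sum_sub_distrib, ← Finset.mul_sum, ← freqNorm_sq]
  simp
  field_simp
  simp

theorem sum_lerayRow_apply (k : Freq) (i : Fin 3) (x : Fin 3 → ℂ) :
    ∑ j, (lerayRow k i j : ℂ) * x j =
      x i - k i * ((∑ j, x j * (k j : ℂ)) / (freqNorm k : ℂ) ^ 2) := by
  have h : ∀ j, (lerayRow k i j : ℂ) * x j =
      (if j = i then x j else 0) - k i / (freqNorm k : ℂ) ^ 2 * (x j * (k j : ℂ)) := by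
    intro j
    simp only [lerayRow]
    split_ifs <;> push_cast <;> ring
  simp_rw [h]
  rw [Finset.sum_sub_distrib, ← Finset.mul_sum]
  simp
  ring

theorem contract_lerayRow {s : ℝ} {w : VectorSeries} (hw : w ∈ VSub s) (k : Freq) (i : Fin 3) :
    contract (lerayRow k i) w k = w k i := by
  rw [contract, sum_lerayRow_apply, hw.2.2 k]
  simp

/-- The `k`-th Fourier coefficient of the pressure-free right-hand side of the velocity equation. -/
def velocityRate (α β ν : ℝ) (v : VectorSeries) (θ : ScalarSeries) (k : Freq) (i : Fin 3) : ℂ :=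
  ∑ j, (lerayRow k i j : ℂ) * velocityForce α β ν v θ k j

/-- Each row of the Leray projector is orthogonal to k, hence an admissible polarisation, and the
projector fixes divergence-free coefficients, so every component is recovered. -/
theorem IsWeakSolution.velocity_coeff (h : IsWeakSolution α β ν T v₀ θ₀ v θ)
    (hc : RegularCurve r q T M v θ) (hr : 0 ≤ r) (hα : 0 ≤ α)
    (hrr : 3 < r + 2 * α + r) {k : Freq} (hk : k ≠ 0) (i : Fin 3) {t : ℝ} (ht : t ∈ Icc 0 T) :
    v t k i = v₀ k i + ∫ s in (0 : ℝ)..t, velocityRate α β ν (v s) (θ s) k i := by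
  have := h.velocity_mode hc hr hα hrr hk (sum_lerayRow_mul hk i) ht
  rwa [contract_lerayRow (hc.v_mem t ht), contract_lerayRow h.v₀_mem] at this

/-! ### Time derivatives of the modes -/

theorem hasDerivAt_of_eq_integral {f g : ℝ → ℂ} {c : ℂ} (hg : ContinuousOn g (Icc 0 T))
    (hfg : ∀ t ∈ Icc 0 T, f t = c + ∫ s in (0 : ℝ)..t, g s) {t : ℝ} (ht : t ∈ Ioo 0 T) :
    HasDerivAt f (g t) t := by
  have ht' : t ∈ Icc 0 T := Ioo_subset_Icc_self ht
  have h1 : ContinuousAt g t := hg.continuousAt (Icc_mem_nhds ht.1 ht.2)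
  have h2 : StronglyMeasurableAtFilter g (𝓝 t) volume :=
    ContinuousOn.stronglyMeasurableAtFilter isOpen_Ioo (hg.mono Ioo_subset_Icc_self) t ht
  have h3 := (intervalIntegral.integral_hasDerivAt_right
    (intervalIntegrable_of_continuousOn_Icc ht' hg) h2 h1).const_add c
  refine h3.congr_of_eventuallyEq ?_
  filter_upwards [Icc_mem_nhds ht.1 ht.2] with s hs using hfg s hs

theorem IsWeakSolution.hasDerivAt_θ (h : IsWeakSolution α β ν T v₀ θ₀ v θ)
    (hc : RegularCurve r q T M v θ) (hr : 0 ≤ r) (hα : 0 ≤ α) (hq : 0 ≤ q)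
    (hrq : 3 < r + 2 * α + q) {k : Freq} (hk : k ≠ 0) {t : ℝ} (ht : t ∈ Ioo 0 T) :
    HasDerivAt (fun s => θ s k) (fluxCoeff (Lam (-2 * α) (v t)) (θ t) k) t :=
  hasDerivAt_of_eq_integral (hc.continuousOn_flux_θ hr hα hq hrq k)
    (fun _ hs => h.temperature_mode hc hr hα hq hrq hk hs) ht

theorem RegularCurve.continuousOn_velocityRate (hc : RegularCurve r q T M v θ) (hr : 0 ≤ r)
    (hα : 0 ≤ α) (hrr : 3 < r + 2 * α + r) (k : Freq) (i : Fin 3) :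
    ContinuousOn (fun s => velocityRate α β ν (v s) (θ s) k i) (Icc 0 T) :=
  continuousOn_finsetSum _ fun j _ =>
    continuousOn_const.mul (hc.continuousOn_velocityForce hr hα hrr k j)

theorem IsWeakSolution.hasDerivAt_v (h : IsWeakSolution α β ν T v₀ θ₀ v θ)
    (hc : RegularCurve r q T M v θ) (hr : 0 ≤ r) (hα : 0 ≤ α)
    (hrr : 3 < r + 2 * α + r) {k : Freq} (hk : k ≠ 0) (i : Fin 3) {t : ℝ} (ht : t ∈ Ioo 0 T) :
    HasDerivAt (fun s => v s k i) (velocityRate α β ν (v t) (θ t) k i) t :=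
  hasDerivAt_of_eq_integral (hc.continuousOn_velocityRate hr hα hrr k i)
    (fun _ hs => h.velocity_coeff hc hr hα hrr hk i hs) ht

end Modes

/-! ### Estimates for the transport terms -/

theorem weightedNorm_sq {s : ℝ} (f : Freq → ℝ) :
    weightedNorm s f ^ 2 = ∑' k, f k ^ 2 * freqNorm k ^ (2 * s) :=
  Real.sq_sqrt (tsum_nonneg fun k => mul_nonneg (sq_nonneg _)
    (Real.rpow_nonneg (freqNorm_nonneg k) _))

theorem weightedNorm_le {s N : ℝ} {f : Freq → ℝ} (hN : 0 ≤ N)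
    (h : ∑' k, f k ^ 2 * freqNorm k ^ (2 * s) ≤ N ^ 2) : weightedNorm s f ≤ N :=
  Real.sqrt_le_iff.2 ⟨hN, h⟩

/-- The summand of `⟨-div (f u), h⟩ = ∑ₖ ∑ₗ`. -/
def fluxTerm (u : VectorSeries) (f h : ScalarSeries) (p : Freq × Freq) : ℂ :=
  conj (h p.1) * (-Complex.I * (∑ j, (p.1 j : ℂ) * u p.2 j) * f (p.1 - p.2))

/-- Since l·u_l = 0, the derivative can be moved from the product onto the transported factor, which
sits at frequency k - l. -/
theorem freq_dot_sub {u : VectorSeries} (hdiv : ∀ k, ∑ i, u k i * (k i : ℂ) = 0) (k l : Freq) :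
    ∑ j, (k j : ℂ) * u l j = ∑ j, ((k - l) j : ℂ) * u l j := by
  have h := hdiv l
  simp only [Pi.sub_apply, Int.cast_sub, sub_mul, Finset.sum_sub_distrib]
  rw [Finset.sum_congr rfl fun j _ => mul_comm (l j : ℂ) (u l j), h, sub_zero]

/-- Transport by a divergence-free field is antisymmetric. -/
theorem tsum_fluxTerm_self {u : VectorSeries} (hdiv : ∀ k, ∑ i, u k i * (k i : ℂ) = 0)
    {f : ScalarSeries} (hf : ∀ k, f (-k) = conj (f k)) : ∑' p, fluxTerm u f f p = 0 := by
  -- This involution exchanges the two copies of f, by reality of f, and flips the sign of k·u_l. No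
  -- summability is needed: reindexing and negation commute with `tsum` unconditionally.
  let e : Freq × Freq ≃ Freq × Freq :=
    { toFun := fun p => (p.2 - p.1, p.2)
      invFun := fun p => (p.2 - p.1, p.2)
      left_inv := fun p => by simp
      right_inv := fun p => by simp }
  have h : ∀ p, fluxTerm u f f (e p) = -fluxTerm u f f p := by
    rintro ⟨k, l⟩
    have h1 : ∑ j, ((l - k) j : ℂ) * u l j = -∑ j, (k j : ℂ) * u l j := by
      rw [freq_dot_sub hdiv (l - k) l, ← Finset.sum_neg_distrib]
      exact Finset.sum_congr rfl fun j _ => by simp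
    have h2 : l - k - l = -k := by abel
    have h3 : -(l - k) = k - l := by abel
    simp only [fluxTerm, e, Equiv.coe_fn_mk, ← hf, h2, h3]
    rw [h1]
    ring
  have h4 := e.tsum_eq (fluxTerm u f f)
  simp_rw [h, tsum_neg] at h4
  linear_combination -(1 / 2) * h4

/-- The divergence condition puts the single derivative on f, so the product estimate applies with
exponents a and q - 1. The last conclusion is Fubini for the absolutely convergent double series; it
makes the antisymmetry of the double sum available. -/
theorem exists_flux_bound {a q : ℝ} (ha : 0 ≤ a) (hq : 1 ≤ q) (haq : 5 / 2 < a + q) :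
    ∃ C, 0 ≤ C ∧ ∀ (u : VectorSeries) (f h : ScalarSeries),
      (∀ k, ∑ i, u k i * (k i : ℂ) = 0) → u 0 = 0 → f 0 = 0 →
      (Summable fun k => ‖u k‖ ^ 2 * freqNorm k ^ (2 * a)) →
      (Summable fun k => ‖f k‖ ^ 2 * freqNorm k ^ (2 * q)) → (Summable fun k => ‖h k‖ ^ 2) →
      (Summable fun k => ‖conj (h k) * fluxCoeff u f k‖) ∧
        ∑' k, ‖conj (h k) * fluxCoeff u f k‖ ≤ C * (weightedNorm a (fun k => ‖u k‖) *
          weightedNorm q (fun k => ‖f k‖) * √(∑' k, ‖h k‖ ^ 2)) ∧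
        ∑' k, conj (h k) * fluxCoeff u f k = ∑' p, fluxTerm u f h p := by
  obtain ⟨C, hC0, hC⟩ := exists_trilinear_bound ha (b := q - 1) (by linarith) (by linarith)
  refine ⟨3 * C, by positivity, fun u f h hdiv u0 f0 hu hf hh => ?_⟩
  have hg : ∀ k, (freqNorm k * ‖f k‖) ^ 2 * freqNorm k ^ (2 * (q - 1)) =
      ‖f k‖ ^ 2 * freqNorm k ^ (2 * q) := by
    intro k
    rcases eq_or_ne k 0 with rfl | hk
    · simp [f0]
    · have hp := freqNorm_pos hk
      rw [mul_pow, ← Real.rpow_two (freqNorm k), mul_comm (freqNorm k ^ (2 : ℝ)), mul_assoc,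
        ← Real.rpow_add hp]
      congr 2; ring
  obtain ⟨hs, hle⟩ := hC (fun k => ‖u k‖) (fun k => freqNorm k * ‖f k‖) (fun k => ‖h k‖)
    (fun _ => norm_nonneg _) (fun k => mul_nonneg (freqNorm_nonneg k) (norm_nonneg _))
    (fun _ => norm_nonneg _) (by simp [u0]) (by simp [f0]) hu
    (hf.congr fun k => (hg k).symm) hh
  have hgn : weightedNorm (q - 1) (fun k => freqNorm k * ‖f k‖) =
      weightedNorm q fun k => ‖f k‖ := by
    rw [weightedNorm, weightedNorm, tsum_congr hg]
  rw [hgn] at hle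
  have hpt : ∀ p : Freq × Freq, ‖fluxTerm u f h p‖ ≤
      3 * (‖u p.2‖ * (freqNorm (p.1 - p.2) * ‖f (p.1 - p.2)‖) * ‖h p.1‖) := by
    rintro ⟨k, l⟩
    simp only [fluxTerm, freq_dot_sub hdiv k l, norm_mul, RCLike.norm_conj, norm_neg,
      Complex.norm_I, one_mul]
    have h1 := norm_dot_le (fun j => ((k - l) j : ℂ)) (norm_freq_le (k - l)) (u l)
    have h2 := mul_le_mul_of_nonneg_right h1 (mul_nonneg (norm_nonneg (f (k - l)))
      (norm_nonneg (h k)))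
    linarith [h2]
  have hn : Summable fun p => ‖fluxTerm u f h p‖ :=
    Summable.of_nonneg_of_le (fun _ => norm_nonneg _) hpt (hs.mul_left 3)
  have hn' : ∑' p, ‖fluxTerm u f h p‖ ≤ 3 * C * (weightedNorm a (fun k => ‖u k‖) *
      weightedNorm q (fun k => ‖f k‖) * √(∑' k, ‖h k‖ ^ 2)) := by
    refine (hn.tsum_le_tsum hpt (hs.mul_left 3)).trans ?_
    rw [tsum_mul_left, mul_assoc]
    exact mul_le_mul_of_nonneg_left hle (by norm_num)
  have hrow : ∀ k, conj (h k) * fluxCoeff u f k = ∑' l, fluxTerm u f h (k, l) := fun k => by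
    simp only [fluxCoeff, fluxTerm, tsum_mul_left]
  have hrow' : ∀ k, ‖conj (h k) * fluxCoeff u f k‖ ≤ ∑' l, ‖fluxTerm u f h (k, l)‖ := fun k => by
    rw [hrow]; exact norm_tsum_le_tsum_norm (hn.prod_factor k)
  have hsum : Summable fun k => ‖conj (h k) * fluxCoeff u f k‖ :=
    Summable.of_nonneg_of_le (fun _ => norm_nonneg _) hrow' hn.prod
  refine ⟨hsum, ?_, ?_⟩
  · refine (hsum.tsum_le_tsum hrow' hn.prod).trans ?_
    rwa [← hn.tsum_prod]
  · rw [tsum_congr hrow, ← (Summable.of_norm hn).tsum_prod]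

theorem fluxCoeff_sub {u₁ u₂ : VectorSeries} {f₁ f₂ : ScalarSeries}
    (hu₁ : Summable fun k => ‖u₁ k‖ ^ 2) (hu₂ : Summable fun k => ‖u₂ k‖ ^ 2)
    (hu : Summable fun k => ‖(u₁ - u₂) k‖ ^ 2)
    (hf₁ : Summable fun k => ‖f₁ k‖ ^ 2) (hf₂ : Summable fun k => ‖f₂ k‖ ^ 2)
    (hf : Summable fun k => ‖(f₁ - f₂) k‖ ^ 2) (k : Freq) :
    fluxCoeff u₁ f₁ k - fluxCoeff u₂ f₂ k =
      fluxCoeff (u₁ - u₂) f₁ k + fluxCoeff u₂ (f₁ - f₂) k := by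
  simp only [fluxCoeff]
  rw [← Summable.tsum_sub (summable_flux hu₁ hf₁ k) (summable_flux hu₂ hf₂ k),
    ← Summable.tsum_add (summable_flux hu hf₁ k) (summable_flux hu₂ hf k)]
  refine tsum_congr fun l => ?_
  simp only [Pi.sub_apply, PiLp.sub_apply, mul_sub, Finset.sum_sub_distrib]
  ring

/-- Energy estimate for the difference of two transport terms. -/
theorem exists_flux_sub_bound {a q : ℝ} (ha : 0 ≤ a) (hq : 1 ≤ q) (haq : 5 / 2 < a + q) :
    ∃ C, 0 ≤ C ∧ ∀ (u₁ u₂ : VectorSeries) (f₁ f₂ : ScalarSeries) (A F : ℝ), 0 ≤ A → 0 ≤ F →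
      u₁ ∈ VSub a → u₂ ∈ VSub a → f₁ ∈ HSub q → f₂ ∈ HSub q →
      weightedNorm a (fun k => ‖u₂ k‖) ≤ A →
      weightedNorm q (fun k => ‖f₁ k‖) ≤ F → weightedNorm q (fun k => ‖(f₁ - f₂) k‖) ≤ F →
      (Summable fun k => ‖conj ((f₁ - f₂) k) * (fluxCoeff u₁ f₁ k - fluxCoeff u₂ f₂ k)‖) ∧
        ∑' k, ‖conj ((f₁ - f₂) k) * (fluxCoeff u₁ f₁ k - fluxCoeff u₂ f₂ k)‖ ≤
          C * ((weightedNorm a (fun k => ‖(u₁ - u₂) k‖) + A) * F *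
            √(∑' k, ‖(f₁ - f₂) k‖ ^ 2)) ∧
        ‖∑' k, conj ((f₁ - f₂) k) * (fluxCoeff u₁ f₁ k - fluxCoeff u₂ f₂ k)‖ ≤
          C * (weightedNorm a (fun k => ‖(u₁ - u₂) k‖) * F * √(∑' k, ‖(f₁ - f₂) k‖ ^ 2)) := by
  obtain ⟨C, hC0, hC⟩ := exists_flux_bound ha hq haq
  refine ⟨C, hC0, fun u₁ u₂ f₁ f₂ A F hA hF hu₁ hu₂ hf₁ hf₂ hA₂ hF₁ hF₂ => ?_⟩
  have hu := sub_mem hu₁ hu₂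
  have hf := sub_mem hf₁ hf₂
  have hq0 : 0 ≤ q := by linarith
  have sf := summable_norm_sq hf.1.1 hq0 hf.1.2
  obtain ⟨s1, b1, -⟩ := hC (u₁ - u₂) f₁ (f₁ - f₂) hu.2.2 hu.1.1 hf₁.1.1 hu.1.2 hf₁.1.2 sf
  obtain ⟨s2, b2, e2⟩ := hC u₂ (f₁ - f₂) (f₁ - f₂) hu₂.2.2 hu₂.1.1 hf.1.1 hu₂.1.2 hf.1.2 sf
  -- The cancellation: transport of f₁ - f₂ by u₂ drops out of the signed sum. It persists in the
  -- sum of absolute values, which is why A enters only that bound.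
  rw [tsum_fluxTerm_self hu₂.2.2 hf.2] at e2
  set U := weightedNorm a (fun k => ‖(u₁ - u₂) k‖)
  set N := √(∑' k, ‖(f₁ - f₂) k‖ ^ 2)
  have hU : 0 ≤ U := weightedNorm_nonneg _ _
  have hN : 0 ≤ N := Real.sqrt_nonneg _
  have b1' : ∑' k, ‖conj ((f₁ - f₂) k) * fluxCoeff (u₁ - u₂) f₁ k‖ ≤ C * (U * F * N) :=
    b1.trans (mul_le_mul_of_nonneg_left (mul_le_mul_of_nonneg_right
      (mul_le_mul_of_nonneg_left hF₁ hU) hN) hC0)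
  have b2' : ∑' k, ‖conj ((f₁ - f₂) k) * fluxCoeff u₂ (f₁ - f₂) k‖ ≤ C * (A * F * N) :=
    b2.trans (mul_le_mul_of_nonneg_left (mul_le_mul_of_nonneg_right
      (mul_le_mul hA₂ hF₂ (weightedNorm_nonneg _ _) hA) hN) hC0)
  have hsplit : ∀ k, conj ((f₁ - f₂) k) * (fluxCoeff u₁ f₁ k - fluxCoeff u₂ f₂ k) =
      conj ((f₁ - f₂) k) * fluxCoeff (u₁ - u₂) f₁ k +
        conj ((f₁ - f₂) k) * fluxCoeff u₂ (f₁ - f₂) k := fun k => by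
    rw [fluxCoeff_sub (summable_norm_sq hu₁.1.1 ha hu₁.1.2) (summable_norm_sq hu₂.1.1 ha hu₂.1.2)
      (summable_norm_sq hu.1.1 ha hu.1.2) (summable_norm_sq hf₁.1.1 hq0 hf₁.1.2)
      (summable_norm_sq hf₂.1.1 hq0 hf₂.1.2) sf, mul_add]
  simp_rw [hsplit]
  have hs := Summable.of_nonneg_of_le (fun _ => norm_nonneg _) (fun k => norm_add_le
    (conj ((f₁ - f₂) k) * fluxCoeff (u₁ - u₂) f₁ k)
    (conj ((f₁ - f₂) k) * fluxCoeff u₂ (f₁ - f₂) k)) (s1.add s2)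
  refine ⟨hs, ?_, ?_⟩
  · refine (hs.tsum_le_tsum (fun k => norm_add_le _ _) (s1.add s2)).trans ?_
    rw [s1.tsum_add s2]
    linarith
  · rw [Summable.tsum_add s1.of_norm s2.of_norm, e2, add_zero]
    exact (norm_tsum_le_tsum_norm s1).trans b1'

/-! ### The energy of the difference of two solutions -/

theorem Lam_sub {E : Type*} [AddCommGroup E] [Module ℝ E] (s : ℝ) (f g : Freq → E) :
    Lam s (f - g) = Lam s f - Lam s g := by
  funext k; simp [Lam, smul_sub]

theorem Lam_mem_VSub {s p m : ℝ} {w : VectorSeries} (hw : w ∈ VSub s) (h : p + m ≤ s) :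
    Lam p w ∈ VSub m := by
  refine ⟨⟨Lam_apply_zero p hw.1.1, ?_⟩, fun k i => ?_, fun k => ?_⟩
  · exact (Lam_summable hw.1.1 h hw.1.2).1.congr fun k => (norm_sq_Lam_mul hw.1.1 p m k).symm
  · simp [Lam, freqNorm_neg, hw.2.1]
  · have := hw.2.2 k
    simp only [Lam, PiLp.smul_apply, Complex.real_smul, mul_assoc, ← Finset.mul_sum, this, mul_zero]

theorem weightedNorm_Lam {E : Type*} [NormedAddCommGroup E] [NormedSpace ℝ E] {f : Freq → E}
    (f0 : f 0 = 0) (s p : ℝ) :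
    weightedNorm p (fun k => ‖Lam s f k‖) = weightedNorm (s + p) fun k => ‖f k‖ := by
  rw [weightedNorm, weightedNorm, tsum_congr fun k => norm_sq_Lam_mul f0 s p k]

theorem component_mem_HSub {s : ℝ} {w : VectorSeries} (hw : w ∈ VSub s) (i : Fin 3) :
    component i w ∈ HSub s ∧ ∑' k, ‖component i w k‖ ^ 2 * freqNorm k ^ (2 * s) ≤
      ∑' k, ‖w k‖ ^ 2 * freqNorm k ^ (2 * s) := by
  have hle : ∀ k, ‖component i w k‖ ^ 2 * freqNorm k ^ (2 * s) ≤
      ‖w k‖ ^ 2 * freqNorm k ^ (2 * s) := fun k =>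
    mul_le_mul_of_nonneg_right
      (pow_le_pow_left₀ (norm_nonneg _) (PiLp.norm_apply_le (w k) i) 2)
      (Real.rpow_nonneg (freqNorm_nonneg k) _)
  have hs := Summable.of_nonneg_of_le
    (fun k => mul_nonneg (sq_nonneg _) (Real.rpow_nonneg (freqNorm_nonneg k) _)) hle hw.1.2
  exact ⟨⟨⟨by simp [component, hw.1.1], hs⟩, fun k => hw.2.1 k i⟩, hs.tsum_le_tsum hle hw.1.2⟩

theorem HSub_mono {s p : ℝ} (h : p ≤ s) {f : ScalarSeries} (hf : f ∈ HSub s) : f ∈ HSub p :=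
  ⟨⟨hf.1.1, (Lam_summable hf.1.1 h hf.1.2).1⟩, hf.2⟩

/-- The contribution of the transport term of the `i`-th velocity component to the energy. -/
def velocityTransport (α : ℝ) (v₁ v₂ : VectorSeries) (i : Fin 3) (k : Freq) : ℂ :=
  conj ((component i v₁ - component i v₂) k) *
    (fluxCoeff (Lam (-2 * α) v₁) (component i v₁) k -
      fluxCoeff (Lam (-2 * α) v₂) (component i v₂) k)

/-- The contribution of the transport term of the temperature to the energy. -/
def temperatureTransport (α : ℝ) (v₁ v₂ : VectorSeries) (θ₁ θ₂ : ScalarSeries) (k : Freq) : ℂ :=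
  conj ((θ₁ - θ₂) k) *
    (fluxCoeff (Lam (-2 * α) v₁) θ₁ k - fluxCoeff (Lam (-2 * α) v₂) θ₂ k)

/-- The time derivative of `|(v₁ - v₂)ₖ|² + |(θ₁ - θ₂)ₖ|²` for solutions of the equations. -/
def energyRate (α β ν : ℝ) (v₁ v₂ : VectorSeries) (θ₁ θ₂ : ScalarSeries) (k : Freq) : ℝ :=
  2 * ((∑ i, conj ((v₁ - v₂) k i) *
    (velocityRate α β ν v₁ θ₁ k i - velocityRate α β ν v₂ θ₂ k i)) +
      temperatureTransport α v₁ v₂ θ₁ θ₂ k).re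

/-- The projector only removes a multiple of k from G, and w k is orthogonal to k. -/
theorem sum_conj_mul_lerayRow {s : ℝ} {w : VectorSeries} (hw : w ∈ VSub s) (k : Freq)
    (G : Fin 3 → ℂ) :
    ∑ i, conj (w k i) * ∑ j, (lerayRow k i j : ℂ) * G j = ∑ i, conj (w k i) * G i := by
  have h : ∑ i, conj (w k i) * (k i : ℂ) = 0 := by
    have := congrArg conj (hw.2.2 k)
    simpa using this
  simp_rw [sum_lerayRow_apply, mul_sub, Finset.sum_sub_distrib, ← mul_assoc, ← Finset.sum_mul, h]
  simp

theorem energyRate_eq {α β ν s : ℝ} {v₁ v₂ : VectorSeries} (θ₁ θ₂ : ScalarSeries)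
    (hv : v₁ - v₂ ∈ VSub s) (k : Freq) :
    energyRate α β ν v₁ v₂ θ₁ θ₂ k =
      2 * ((∑ i, velocityTransport α v₁ v₂ i k) + temperatureTransport α v₁ v₂ θ₁ θ₂ k).re -
        2 * ν * (‖(v₁ - v₂) k‖ ^ 2 * freqNorm k ^ (2 * β)) +
        2 * (conj ((v₁ - v₂) k 2) * (θ₁ - θ₂) k).re := by
  have h1 : ∑ i, conj ((v₁ - v₂) k i) *
      (velocityRate α β ν v₁ θ₁ k i - velocityRate α β ν v₂ θ₂ k i) =
      ∑ i, conj ((v₁ - v₂) k i) *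
        (velocityForce α β ν v₁ θ₁ k i - velocityForce α β ν v₂ θ₂ k i) := by
    rw [← sum_conj_mul_lerayRow hv k fun i =>
      velocityForce α β ν v₁ θ₁ k i - velocityForce α β ν v₂ θ₂ k i]
    refine Finset.sum_congr rfl fun i _ => ?_
    simp only [velocityRate, mul_sub, Finset.sum_sub_distrib]
  have h2 : ∀ i, conj ((v₁ - v₂) k i) *
      (velocityForce α β ν v₁ θ₁ k i - velocityForce α β ν v₂ θ₂ k i) =
      velocityTransport α v₁ v₂ i k -
        ν * ((freqNorm k ^ (2 * β) : ℝ) : ℂ) * ((‖(v₁ - v₂) k i‖ ^ 2 : ℝ) : ℂ) +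
        if i = 2 then conj ((v₁ - v₂) k i) * (θ₁ - θ₂) k else 0 := by
    intro i
    push_cast
    rw [← Complex.conj_mul']
    simp only [velocityForce, velocityTransport, component, Pi.sub_apply, PiLp.sub_apply]
    split_ifs <;> ring
  have h3 : ‖(v₁ - v₂) k‖ ^ 2 = ∑ i, ‖(v₁ - v₂) k i‖ ^ 2 := EuclideanSpace.norm_sq_eq _
  rw [energyRate, h1, Finset.sum_congr rfl fun i _ => h2 i, Finset.sum_add_distrib,
    Finset.sum_sub_distrib, ← Finset.mul_sum, ← Complex.ofReal_sum, ← h3,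
    Finset.sum_ite_eq' Finset.univ, if_pos (Finset.mem_univ _), ← Complex.ofReal_mul,
    ← Complex.ofReal_mul]
  simp only [Complex.add_re, Complex.sub_re, Complex.ofReal_re]
  ring

theorem two_mul_re_conj_mul_le (z w : ℂ) : |2 * (conj z * w).re| ≤ ‖z‖ ^ 2 + ‖w‖ ^ 2 := by
  have h := Complex.abs_re_le_norm (conj z * w)
  rw [norm_mul, RCLike.norm_conj] at h
  rw [abs_mul, abs_two]
  nlinarith [sq_nonneg (‖z‖ - ‖w‖)]

/-- Completing the square uses half of the dissipation term; the other νX² is discarded. -/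
theorem young_absorb {ν K X y : ℝ} (hν : 0 < ν) :
    2 * (K * X * y) - 2 * ν * X ^ 2 ≤ K ^ 2 / ν * y ^ 2 := by
  have h : K ^ 2 / ν * y ^ 2 - (2 * (K * X * y) - 2 * ν * X ^ 2) =
      (ν * X - K * y) ^ 2 / ν + ν * X ^ 2 := by field_simp; ring
  have h' : 0 ≤ (ν * X - K * y) ^ 2 / ν + ν * X ^ 2 := by positivity
  linarith

/-- The energy inequality for the difference of two solutions, at a fixed time. -/
theorem exists_energyRate_bound {α β ν r q T M : ℝ} {v₁ v₂ : ℝ → VectorSeries}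
    {θ₁ θ₂ : ℝ → ScalarSeries} (hν : 0 < ν) (hα : 0 ≤ α) (hβ : 0 ≤ β) (hβr : β ≤ r) (hqr : q ≤ r)
    (hq : 1 ≤ q) (hβq : 5 / 2 < β + 2 * α + q) (h₁ : RegularCurve r q T M v₁ θ₁)
    (h₂ : RegularCurve r q T M v₂ θ₂)
    (h : RegularCurve r q T M (fun t => v₁ t - v₂ t) (fun t => θ₁ t - θ₂ t)) :
    ∃ C D, ∀ t ∈ Icc 0 T,
      (Summable fun k => |energyRate α β ν (v₁ t) (v₂ t) (θ₁ t) (θ₂ t) k|) ∧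
      ∑' k, |energyRate α β ν (v₁ t) (v₂ t) (θ₁ t) (θ₂ t) k| ≤ D ∧
      ∑' k, energyRate α β ν (v₁ t) (v₂ t) (θ₁ t) (θ₂ t) k ≤
        C * ∑' k, (‖(v₁ t - v₂ t) k‖ ^ 2 + ‖(θ₁ t - θ₂ t) k‖ ^ 2) := by
  -- With this a the velocity norm ‖Λ^(-2α) v‖_a is ‖v‖_β, the dissipation norm.
  obtain ⟨C, hC0, hC⟩ := exists_flux_sub_bound (a := β + 2 * α) (by linarith) hq hβq
  have hM := h.bound_nonneg
  -- In the first constant, 18 covers (3Nv + Nθ)² ≤ 18(Nv² + Nθ²), with three velocity components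
  -- and one temperature, and 1 is the buoyancy. The second adds four transport terms, the
  -- dissipation and the buoyancy, all bounded through M.
  refine ⟨(C * M) ^ 2 / ν * 18 + 1, 2 * (4 * (C * ((M + M) * M * M))) + 2 * ν * M ^ 2 + 2 * M ^ 2,
    fun t ht => ?_⟩
  have hv₁ := h₁.v_mem t ht
  have hv₂ := h₂.v_mem t ht
  have hv := h.v_mem t ht
  have hθ := h.θ_mem t ht
  have hr0 : 0 ≤ r := hβ.trans hβr
  have hq0 : 0 ≤ q := by linarith
  set v := v₁ t - v₂ t with hvdef
  set θ := θ₁ t - θ₂ t with hθdef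
  have hu₁ : Lam (-2 * α) (v₁ t) ∈ VSub (β + 2 * α) := Lam_mem_VSub hv₁ (by linarith)
  have hu₂ : Lam (-2 * α) (v₂ t) ∈ VSub (β + 2 * α) := Lam_mem_VSub hv₂ (by linarith)
  have hαβ : -2 * α + (β + 2 * α) = β := by ring
  have hA : weightedNorm (β + 2 * α) (fun k => ‖Lam (-2 * α) (v₂ t) k‖) ≤ M := by
    rw [weightedNorm_Lam hv₂.1.1, hαβ]
    exact weightedNorm_le hM ((Lam_summable hv₂.1.1 hβr hv₂.1.2).2.trans (h₂.v_le t ht))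
  set X := weightedNorm β fun k => ‖v k‖
  have hX0 : 0 ≤ X := weightedNorm_nonneg _ _
  have sX := (Lam_summable hv.1.1 hβr hv.1.2).1
  have hX : weightedNorm (β + 2 * α)
      (fun k => ‖(Lam (-2 * α) (v₁ t) - Lam (-2 * α) (v₂ t)) k‖) = X := by
    rw [← Lam_sub, weightedNorm_Lam hv.1.1, hαβ]
  have hXM : X ≤ M := weightedNorm_le hM ((Lam_summable hv.1.1 hβr hv.1.2).2.trans (h.v_le t ht))
  have sv := summable_norm_sq hv.1.1 hr0 hv.1.2
  have sθ := summable_norm_sq hθ.1.1 hq0 hθ.1.2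
  have hvM : ∑' k, ‖v k‖ ^ 2 ≤ M ^ 2 := by
    have := (Lam_summable hv.1.1 hr0 hv.1.2).2.trans (h.v_le t ht)
    simpa using this
  have hθM : ∑' k, ‖θ k‖ ^ 2 ≤ M ^ 2 := by
    have := (Lam_summable hθ.1.1 hq0 hθ.1.2).2.trans (h.θ_le t ht)
    simpa using this
  set Nv := √(∑' k, ‖v k‖ ^ 2)
  set Nθ := √(∑' k, ‖θ k‖ ^ 2)
  have hNv0 : 0 ≤ Nv := Real.sqrt_nonneg _
  have hNθ0 : 0 ≤ Nθ := Real.sqrt_nonneg _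
  have hNvM : Nv ≤ M := Real.sqrt_le_iff.2 ⟨hM, hvM⟩
  have hNθM : Nθ ≤ M := Real.sqrt_le_iff.2 ⟨hM, hθM⟩
  have hNv : Nv ^ 2 = ∑' k, ‖v k‖ ^ 2 := Real.sq_sqrt (tsum_nonneg fun _ => sq_nonneg _)
  have hNθ : Nθ ^ 2 = ∑' k, ‖θ k‖ ^ 2 := Real.sq_sqrt (tsum_nonneg fun _ => sq_nonneg _)
  have hmono : ∀ {N : ℝ}, 0 ≤ N → N ≤ M →
      C * ((X + M) * M * N) ≤ C * ((M + M) * M * M) := fun hN hNM =>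
    mul_le_mul_of_nonneg_left (mul_le_mul (mul_le_mul_of_nonneg_right (by linarith) hM) hNM hN
      (by positivity)) hC0
  have hvi : ∀ i, (Summable fun k => ‖velocityTransport α (v₁ t) (v₂ t) i k‖) ∧
      ∑' k, ‖velocityTransport α (v₁ t) (v₂ t) i k‖ ≤ C * ((M + M) * M * M) ∧
      ‖∑' k, velocityTransport α (v₁ t) (v₂ t) i k‖ ≤ C * (X * M * Nv) := by
    intro i
    have c₁ := component_mem_HSub hv₁ i
    have c := component_mem_HSub hv i
    have n₁ := c₁.2.trans (h₁.v_le t ht)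
    have n := c.2.trans (h.v_le t ht)
    have hN : √(∑' k, ‖(component i (v₁ t) - component i (v₂ t)) k‖ ^ 2) ≤ Nv :=
      Real.sqrt_le_sqrt ((summable_component sv i).tsum_le_tsum (fun k =>
        pow_le_pow_left₀ (norm_nonneg _) (PiLp.norm_apply_le (v k) i) 2) sv)
    have hb := hC (Lam (-2 * α) (v₁ t)) (Lam (-2 * α) (v₂ t)) (component i (v₁ t))
      (component i (v₂ t)) M M hM hM hu₁ hu₂ (HSub_mono hqr c₁.1)
      (HSub_mono hqr (component_mem_HSub hv₂ i).1) hA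
      (weightedNorm_le hM ((Lam_summable c₁.1.1.1 hqr c₁.1.1.2).2.trans n₁))
      (weightedNorm_le hM ((Lam_summable c.1.1.1 hqr c.1.1.2).2.trans n))
    rw [hX] at hb
    exact ⟨hb.1, hb.2.1.trans (hmono (Real.sqrt_nonneg _) (hN.trans hNvM)),
      hb.2.2.trans (mul_le_mul_of_nonneg_left
        (mul_le_mul_of_nonneg_left hN (by positivity)) hC0)⟩
  have hth : (Summable fun k => ‖temperatureTransport α (v₁ t) (v₂ t) (θ₁ t) (θ₂ t) k‖) ∧
      ∑' k, ‖temperatureTransport α (v₁ t) (v₂ t) (θ₁ t) (θ₂ t) k‖ ≤ C * ((M + M) * M * M) ∧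
      ‖∑' k, temperatureTransport α (v₁ t) (v₂ t) (θ₁ t) (θ₂ t) k‖ ≤ C * (X * M * Nθ) := by
    have hb := hC (Lam (-2 * α) (v₁ t)) (Lam (-2 * α) (v₂ t)) (θ₁ t) (θ₂ t) M M hM hM hu₁ hu₂
      (h₁.θ_mem t ht) (h₂.θ_mem t ht) hA (weightedNorm_le hM (h₁.θ_le t ht))
      (weightedNorm_le hM (h.θ_le t ht))
    rw [hX] at hb
    exact ⟨hb.1, hb.2.1.trans (hmono hNθ0 hNθM), hb.2.2⟩
  have heq := fun k => energyRate_eq (α := α) (β := β) (ν := ν) (θ₁ t) (θ₂ t) (s := r) hv k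
  have sw : Summable fun k => 2 * ((∑ i, ‖velocityTransport α (v₁ t) (v₂ t) i k‖) +
      ‖temperatureTransport α (v₁ t) (v₂ t) (θ₁ t) (θ₂ t) k‖) +
      2 * ν * (‖v k‖ ^ 2 * freqNorm k ^ (2 * β)) + (‖v k‖ ^ 2 + ‖θ k‖ ^ 2) :=
    ((((summable_sum fun i _ => (hvi i).1).add hth.1).mul_left 2).add (sX.mul_left _)).add
      (sv.add sθ)
  have hbuoy : ∀ k, |2 * (conj (v k 2) * θ k).re| ≤ ‖v k‖ ^ 2 + ‖θ k‖ ^ 2 := fun k =>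
    (two_mul_re_conj_mul_le _ _).trans (add_le_add_left
      (pow_le_pow_left₀ (norm_nonneg _) (PiLp.norm_apply_le (v k) 2) 2) _)
  have hpt : ∀ k, |energyRate α β ν (v₁ t) (v₂ t) (θ₁ t) (θ₂ t) k| ≤
      2 * ((∑ i, ‖velocityTransport α (v₁ t) (v₂ t) i k‖) +
      ‖temperatureTransport α (v₁ t) (v₂ t) (θ₁ t) (θ₂ t) k‖) +
      2 * ν * (‖v k‖ ^ 2 * freqNorm k ^ (2 * β)) + (‖v k‖ ^ 2 + ‖θ k‖ ^ 2) := by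
    intro k
    rw [heq k]
    refine (abs_add_le _ _).trans (add_le_add ((abs_sub _ _).trans (add_le_add ?_ ?_)) (hbuoy k))
    · rw [abs_mul, abs_two]
      refine mul_le_mul_of_nonneg_left ((Complex.abs_re_le_norm _).trans
        ((norm_add_le _ _).trans (add_le_add_left (norm_sum_le _ _) _))) zero_le_two
    · rw [abs_of_nonneg]
      have := Real.rpow_nonneg (freqNorm_nonneg k) (2 * β)
      positivity
  have sabs := Summable.of_nonneg_of_le (fun _ => abs_nonneg _) hpt sw
  refine ⟨sabs, (sabs.tsum_le_tsum hpt sw).trans ?_, ?_⟩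
  · have sT := summable_sum (s := Finset.univ) fun i _ => (hvi i).1
    rw [Summable.tsum_add (((sT.add hth.1).mul_left 2).add (sX.mul_left _)) (sv.add sθ),
      Summable.tsum_add ((sT.add hth.1).mul_left 2) (sX.mul_left _), tsum_mul_left, tsum_mul_left,
      Summable.tsum_add sT hth.1, Summable.tsum_add sv sθ,
      Summable.tsum_finsetSum fun i _ => (hvi i).1]
    have e1 : ∑ i, ∑' k, ‖velocityTransport α (v₁ t) (v₂ t) i k‖ ≤
        ∑ _i : Fin 3, C * ((M + M) * M * M) := Finset.sum_le_sum fun i _ => (hvi i).2.1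
    rw [Finset.sum_const, Finset.card_univ, Fintype.card_fin, nsmul_eq_mul] at e1
    have e2 : 2 * ν * ∑' k, ‖v k‖ ^ 2 * freqNorm k ^ (2 * β) ≤ 2 * ν * M ^ 2 :=
      mul_le_mul_of_nonneg_left
        ((Lam_summable hv.1.1 hβr hv.1.2).2.trans (h.v_le t ht)) (by positivity)
    have e3 := hth.2.1
    push_cast at e1
    linarith
  -- Here the transport terms are summed before norms are taken, so the bounds with cancellation
  -- apply; each is linear in X and is absorbed by the dissipation.
  · have sT : Summable fun k => (∑ i, velocityTransport α (v₁ t) (v₂ t) i k) +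
        temperatureTransport α (v₁ t) (v₂ t) (θ₁ t) (θ₂ t) k :=
      (summable_sum fun i _ => (hvi i).1.of_norm).add hth.1.of_norm
    have sB : Summable fun k => 2 * (conj (v k 2) * θ k).re :=
      Summable.of_norm (Summable.of_nonneg_of_le (fun _ => norm_nonneg _) hbuoy (sv.add sθ))
    have sT' := ((Complex.hasSum_re sT.hasSum).summable.mul_left 2).sub (sX.mul_left (2 * ν))
    rw [tsum_congr heq, Summable.tsum_add sT' sB,
      Summable.tsum_sub ((Complex.hasSum_re sT.hasSum).summable.mul_left 2) (sX.mul_left (2 * ν)),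
      tsum_mul_left, tsum_mul_left, (Complex.hasSum_re sT.hasSum).tsum_eq,
      Summable.tsum_add (summable_sum fun i _ => (hvi i).1.of_norm) hth.1.of_norm,
      Summable.tsum_finsetSum fun i _ => (hvi i).1.of_norm, Summable.tsum_add sv sθ,
      ← hNv, ← hNθ, ← weightedNorm_sq]
    have e1 : ‖(∑ i, ∑' k, velocityTransport α (v₁ t) (v₂ t) i k) +
        ∑' k, temperatureTransport α (v₁ t) (v₂ t) (θ₁ t) (θ₂ t) k‖ ≤
        (∑ _i : Fin 3, C * (X * M * Nv)) + C * (X * M * Nθ) :=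
      (norm_add_le _ _).trans (add_le_add (norm_sum_le_of_le _ fun i _ => (hvi i).2.2) hth.2.2)
    rw [Finset.sum_const, Finset.card_univ, Fintype.card_fin, nsmul_eq_mul] at e1
    push_cast at e1
    have e2 := (Complex.re_le_norm _).trans e1
    have e3 : ∑' k, 2 * (conj (v k 2) * θ k).re ≤ Nv ^ 2 + Nθ ^ 2 := by
      rw [hNv, hNθ, ← Summable.tsum_add sv sθ]
      exact sB.tsum_le_tsum (fun k => (le_abs_self _).trans (hbuoy k)) (sv.add sθ)
    have e4 := young_absorb (K := C * M) (X := X) (y := 3 * Nv + Nθ) hν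
    have e5 : (C * M) ^ 2 / ν * (3 * Nv + Nθ) ^ 2 ≤
        (C * M) ^ 2 / ν * (18 * (Nv ^ 2 + Nθ ^ 2)) :=
      mul_le_mul_of_nonneg_left (by nlinarith [sq_nonneg (Nv - 3 * Nθ)]) (by positivity)
    linarith

/-! ### Gronwall's inequality and uniqueness -/

theorem eq_zero_of_le_mul_integral {T C : ℝ} {E : ℝ → ℝ} (hT : 0 ≤ T) (hE : ContinuousOn E (Icc 0 T))
    (hE0 : ∀ t ∈ Icc 0 T, 0 ≤ E t) (hC : ∀ t ∈ Icc 0 T, E t ≤ C * ∫ s in (0 : ℝ)..t, E s) :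
    ∀ t ∈ Icc 0 T, E t = 0 := by
  -- The constant extension makes the primitive G differentiable everywhere. Gronwall is applied to
  -- G, with G' ≤ C G and G(0) = 0, so E itself is never differentiated.
  let E' : ℝ → ℝ := IccExtend hT (domRestrict (Icc 0 T) E)
  have hE' : Continuous E' := (continuousOn_iff_continuous_domRestrict.1 hE).Icc_extend'
  have heq : ∀ t ∈ Icc 0 T, E' t = E t := fun t ht => IccExtend_of_mem hT _ ht
  have hpos : ∀ t, 0 ≤ E' t := fun t => hE0 _ (projIcc 0 T hT t).2
  let G : ℝ → ℝ := fun t => ∫ s in (0 : ℝ)..t, E' s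
  have hG : ∀ t, HasDerivAt G (E' t) t := fun t =>
    intervalIntegral.integral_hasDerivAt_right (hE'.intervalIntegrable _ _)
      hE'.stronglyMeasurable.stronglyMeasurableAtFilter hE'.continuousAt
  have hGeq : ∀ t ∈ Icc 0 T, G t = ∫ s in (0 : ℝ)..t, E s := fun t ht =>
    integral_congr_of_Icc ht heq
  have hle : ∀ t ∈ Icc 0 T, E' t ≤ C * G t := fun t ht => by
    rw [heq t ht, hGeq t ht]; exact hC t ht
  have hGpos : ∀ t ∈ Icc 0 T, 0 ≤ G t := fun t ht =>
    intervalIntegral.integral_nonneg ht.1 fun s _ => hpos s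
  have hG0 := norm_le_gronwallBound_of_norm_deriv_right_le (f := G) (f' := E') (δ := 0) (K := C)
    (ε := 0) (a := 0) (b := T) (fun t _ => (hG t).continuousAt.continuousWithinAt)
    (fun t _ => (hG t).hasDerivWithinAt) (by simp [G]) fun t ht => by
      rw [Real.norm_of_nonneg (hpos t), Real.norm_of_nonneg (hGpos t (Ico_subset_Icc_self ht)),
        add_zero]
      exact hle t (Ico_subset_Icc_self ht)
  intro t ht
  have h1 := hG0 t ht
  rw [gronwallBound_ε0_δ0, norm_le_zero_iff] at h1
  have h2 := hle t ht
  rw [h1, mul_zero, heq t ht] at h2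
  exact le_antisymm h2 (hE0 t ht)

/-- Termwise differentiation of the energy `∑ₖ eₖ`, with `eₖ(0) = 0` and `eₖ' = dₖ`, followed by
Gronwall's inequality. -/
theorem tsum_eq_zero_of_rate_le {ι : Type*} [Countable ι] {T C D : ℝ} {e d : ι → ℝ → ℝ}
    (hT : 0 ≤ T) (he : ∀ k, ∀ t ∈ Icc 0 T, e k t = ∫ s in (0 : ℝ)..t, d k s)
    (hd : ∀ k, ContinuousOn (d k) (Icc 0 T)) (he0 : ∀ k, ∀ t ∈ Icc 0 T, 0 ≤ e k t)
    (hes : ∀ t ∈ Icc 0 T, Summable fun k => e k t)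
    (hds : ∀ t ∈ Icc 0 T, Summable fun k => |d k t|)
    (hdD : ∀ t ∈ Icc 0 T, ∑' k, |d k t| ≤ D)
    (hdC : ∀ t ∈ Icc 0 T, ∑' k, d k t ≤ C * ∑' k, e k t) :
    ∀ t ∈ Icc 0 T, ∑' k, e k t = 0 := by
  have hsub : ∀ {t}, t ∈ Icc 0 T → uIoc 0 t ⊆ Icc 0 T := fun {t} ht => by
    rw [uIoc_of_le ht.1]
    exact Ioc_subset_Icc_self.trans (Icc_subset_Icc_right ht.2)
  have hFS : ∀ S : Finset ι, ContinuousOn (fun s => ∑ k ∈ S, d k s) (Icc 0 T) := fun S =>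
    continuousOn_finsetSum _ fun k _ => hd k
  have hlim : ∀ s ∈ Icc 0 T, Tendsto (fun S : Finset ι => ∑ k ∈ S, d k s) atTop
      (𝓝 (∑' k, d k s)) := fun s hs => (hds s hs).of_abs.hasSum
  have hFbound : ∀ s ∈ Icc 0 T, ∀ S : Finset ι, ‖∑ k ∈ S, d k s‖ ≤ D := fun s hs S =>
    (norm_sum_le _ _).trans (((hds s hs).sum_le_tsum S fun _ _ => abs_nonneg _).trans (hdD s hs))
  have hmeas : ∀ t ∈ Icc 0 T, ∀ S : Finset ι, AEStronglyMeasurable (fun s => ∑ k ∈ S, d k s)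
      (volume.restrict (uIoc 0 t)) := fun t ht S =>
    ((hFS S).mono (hsub ht)).aestronglyMeasurable measurableSet_uIoc
  have hint : ∀ t ∈ Icc 0 T, IntervalIntegrable (fun s => ∑' k, d k s) volume 0 t := by
    intro t ht
    have hm : AEStronglyMeasurable (fun s => ∑' k, d k s) (volume.restrict (uIoc 0 t)) :=
      aestronglyMeasurable_of_tendsto_ae atTop (hmeas t ht)
        ((ae_restrict_iff' measurableSet_uIoc).2 (Eventually.of_forall fun s hs =>
          hlim s (hsub ht hs)))
    rw [intervalIntegrable_iff]
    have : IsFiniteMeasure (volume.restrict (uIoc 0 t)) := ⟨by simp⟩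
    refine Integrable.of_bound hm D ?_
    refine (ae_restrict_iff' measurableSet_uIoc).2 (Eventually.of_forall fun s hs => ?_)
    exact le_of_tendsto (hlim s (hsub ht hs)).norm
      (Eventually.of_forall (hFbound s (hsub ht hs)))
  -- Dominated convergence along finite subsets of the index set, with the constant D as majorant;
  -- countability of ι makes this filter countably generated.
  have hE : ∀ t ∈ Icc 0 T, ∑' k, e k t = ∫ s in (0 : ℝ)..t, ∑' k, d k s := by
    intro t ht
    have h1 := intervalIntegral.tendsto_integral_filter_of_dominated_convergence
      (μ := volume) (a := 0) (b := t) (l := (atTop : Filter (Finset ι)))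
      (F := fun S s => ∑ k ∈ S, d k s) (f := fun s => ∑' k, d k s) (fun _ => D)
      (Eventually.of_forall (hmeas t ht))
      (Eventually.of_forall fun S => Eventually.of_forall fun s hs =>
        hFbound s (hsub ht hs) S) intervalIntegrable_const
      (Eventually.of_forall fun s hs => hlim s (hsub ht hs))
    refine tendsto_nhds_unique (hes t ht).hasSum (h1.congr fun S => ?_)
    rw [intervalIntegral.integral_finsetSum fun k _ =>
      intervalIntegrable_of_continuousOn_Icc ht (hd k)]
    exact Finset.sum_congr rfl fun k _ => (he k t ht).symm
  have hTm : T ∈ Icc 0 T := ⟨hT, le_rfl⟩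
  -- The total rate is only known to be integrable; its primitive is continuous all the same.
  have hcont : ContinuousOn (fun t => ∑' k, e k t) (Icc 0 T) := by
    have := intervalIntegral.continuousOn_primitive_interval' (hint T hTm) left_mem_uIcc
    rw [uIcc_of_le hT] at this
    exact this.congr hE
  refine eq_zero_of_le_mul_integral (C := C) hT hcont
    (fun t ht => tsum_nonneg fun k => he0 k t ht) fun t ht => ?_
  rw [hE t ht, ← intervalIntegral.integral_const_mul]
  exact intervalIntegral.integral_mono_on ht.1 (hint t ht)
    ((intervalIntegrable_of_continuousOn_Icc ht hcont).const_mul C)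
    fun s hs => hdC s ⟨hs.1, hs.2.trans ht.2⟩

theorem hasDerivAt_norm_sq {f : ℝ → ℂ} {f' : ℂ} {t : ℝ} (h : HasDerivAt f f' t) :
    HasDerivAt (fun s => ‖f s‖ ^ 2) (2 * (conj (f t) * f').re) t := by
  have := h.norm_sq
  simpa [Complex.inner, mul_comm] using this

theorem RegularCurve.mono {r q T M N : ℝ} {v : ℝ → VectorSeries} {θ : ℝ → ScalarSeries}
    (h : RegularCurve r q T M v θ) (hMN : M ≤ N) : RegularCurve r q T N v θ where
  bound_nonneg := h.bound_nonneg.trans hMN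
  v_mem := h.v_mem
  θ_mem := h.θ_mem
  v_cont := h.v_cont
  θ_cont := h.θ_cont
  v_le t ht := (h.v_le t ht).trans (pow_le_pow_left₀ h.bound_nonneg hMN 2)
  θ_le t ht := (h.θ_le t ht).trans (pow_le_pow_left₀ h.bound_nonneg hMN 2)

/-- The energy of the `k`-th mode of the difference is the time integral of its rate. -/
theorem mode_energy_eq_integral {α β ν r q T M : ℝ} {v₀ : VectorSeries} {θ₀ : ScalarSeries}
    {v₁ v₂ : ℝ → VectorSeries} {θ₁ θ₂ : ℝ → ScalarSeries} (hr : 0 ≤ r) (hα : 0 ≤ α) (hq : 0 ≤ q)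
    (hrq : 3 < r + 2 * α + q) (hrr : 3 < r + 2 * α + r)
    (w₁ : IsWeakSolution α β ν T v₀ θ₀ v₁ θ₁) (w₂ : IsWeakSolution α β ν T v₀ θ₀ v₂ θ₂)
    (h₁ : RegularCurve r q T M v₁ θ₁) (h₂ : RegularCurve r q T M v₂ θ₂) (k : Freq) :
    ContinuousOn (fun t => energyRate α β ν (v₁ t) (v₂ t) (θ₁ t) (θ₂ t) k) (Icc 0 T) ∧
    ∀ t ∈ Icc 0 T, ‖(v₁ t - v₂ t) k‖ ^ 2 + ‖(θ₁ t - θ₂ t) k‖ ^ 2 =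
      ∫ s in (0 : ℝ)..t, energyRate α β ν (v₁ s) (v₂ s) (θ₁ s) (θ₂ s) k := by
  have hv : ∀ i, ContinuousOn (fun t => (v₁ t - v₂ t) k i) (Icc 0 T) := fun i =>
    (h₁.component_cont i k).sub (h₂.component_cont i k)
  have hθ : ContinuousOn (fun t => (θ₁ t - θ₂ t) k) (Icc 0 T) := (h₁.θ_cont k).sub (h₂.θ_cont k)
  have hd : ContinuousOn (fun t => energyRate α β ν (v₁ t) (v₂ t) (θ₁ t) (θ₂ t) k) (Icc 0 T) := by
    refine continuousOn_const.mul (Complex.continuous_re.comp_continuousOn (ContinuousOn.add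
      (continuousOn_finsetSum _ fun i _ => ?_) ?_))
    · exact (Complex.continuous_conj.comp_continuousOn (hv i)).mul
        ((h₁.continuousOn_velocityRate hr hα hrr k i).sub
          (h₂.continuousOn_velocityRate hr hα hrr k i))
    · exact (Complex.continuous_conj.comp_continuousOn hθ).mul
        ((h₁.continuousOn_flux_θ hr hα hq hrq k).sub (h₂.continuousOn_flux_θ hr hα hq hrq k))
  refine ⟨hd, fun t ht => ?_⟩
  -- The mean mode carries no equation; both sides vanish by the mean-zero condition.
  rcases eq_or_ne k 0 with rfl | hk
  · have h0 : ∫ s in (0 : ℝ)..t, energyRate α β ν (v₁ s) (v₂ s) (θ₁ s) (θ₂ s) 0 =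
        ∫ _s in (0 : ℝ)..t, (0 : ℝ) := integral_congr_of_Icc ht fun s hs => by
      simp [energyRate, temperatureTransport, h₁.v_zero hs, h₂.v_zero hs, h₁.θ_zero hs,
        h₂.θ_zero hs]
    rw [h0]
    simp [h₁.v_zero ht, h₂.v_zero ht, h₁.θ_zero ht, h₂.θ_zero ht]
  let e : ℝ → ℝ := fun s => (∑ i, ‖(v₁ s - v₂ s) k i‖ ^ 2) + ‖(θ₁ s - θ₂ s) k‖ ^ 2
  have he : ∀ s, ‖(v₁ s - v₂ s) k‖ ^ 2 + ‖(θ₁ s - θ₂ s) k‖ ^ 2 = e s := fun s => by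
    simp only [e, EuclideanSpace.norm_sq_eq]
  have hec : ContinuousOn e (Icc 0 t) :=
    ((continuousOn_finsetSum _ fun i _ => (hv i).norm.pow 2).add (hθ.norm.pow 2)).mono
      (Icc_subset_Icc_right ht.2)
  have hder : ∀ s ∈ Ioo 0 t,
      HasDerivAt e (energyRate α β ν (v₁ s) (v₂ s) (θ₁ s) (θ₂ s) k) s := by
    intro s hs
    have hs' : s ∈ Ioo 0 T := ⟨hs.1, hs.2.trans_le ht.2⟩
    have d1 := fun i => hasDerivAt_norm_sq ((w₁.hasDerivAt_v h₁ hr hα hrr hk i hs').sub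
      (w₂.hasDerivAt_v h₂ hr hα hrr hk i hs'))
    have d2 := hasDerivAt_norm_sq ((w₁.hasDerivAt_θ h₁ hr hα hq hrq hk hs').sub
      (w₂.hasDerivAt_θ h₂ hr hα hq hrq hk hs'))
    have d3 := (HasDerivAt.fun_sum (u := Finset.univ) fun i _ => d1 i).add d2
    refine d3.congr_deriv ?_
    rw [energyRate, Complex.add_re, Complex.re_sum, mul_add, Finset.mul_sum]
    rfl
  have hint := intervalIntegral.integral_eq_sub_of_hasDerivAt_of_le ht.1 hec hder
    (intervalIntegrable_of_continuousOn_Icc ht hd)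
  have hz : (0 : ℝ) ∈ Icc 0 T := ⟨le_rfl, ht.1.trans ht.2⟩
  -- The initial values agree by the integral equations at t = 0, where the integrals vanish and the
  -- common data remain.
  have e0 : e 0 = 0 := by
    have hv0 : ∀ i, v₁ 0 k i = v₂ 0 k i := fun i => by
      rw [w₁.velocity_coeff h₁ hr hα hrr hk i hz, w₂.velocity_coeff h₂ hr hα hrr hk i hz]
      simp
    have hθ0 : θ₁ 0 k = θ₂ 0 k := by
      rw [w₁.temperature_mode h₁ hr hα hq hrq hk hz, w₂.temperature_mode h₂ hr hα hq hrq hk hz]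
      simp
    simp [e, hv0, hθ0]
  rw [hint, he, e0, sub_zero]

end

end Boussinesq

/-! ### The uniqueness theorem -/

theorem theorem4p2 (α β ν r T : ℝ) (hν : 0 < ν) (hT : 0 < T)
    (hβ : 1 / 2 < β) (hβ' : β < 5 / 4) (hαβ : α + β = 5 / 4)
    (hr : max (2 * β) (β + 1) < r)
    (v₀ : Boussinesq.VSpace r) (θ₀ : Boussinesq.HSpace (r - β))
    (v₁ v₂ : ℝ → Boussinesq.VectorSeries) (θ₁ θ₂ : ℝ → Boussinesq.ScalarSeries)
    (h₁ : Boussinesq.IsRegularSolution α β ν r T v₀.coeff θ₀.coeff v₁ θ₁)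
    (h₂ : Boussinesq.IsRegularSolution α β ν r T v₀.coeff θ₀.coeff v₂ θ₂) :
    ∀ t ∈ Set.Icc 0 T, v₁ t = v₂ t ∧ θ₁ t = θ₂ t := by
  obtain ⟨hr1, hr2⟩ := max_lt_iff.1 hr
  obtain ⟨M₁, c₁⟩ := Boussinesq.exists_regularCurve h₁.v_cont h₁.θ_cont
  obtain ⟨M₂, c₂⟩ := Boussinesq.exists_regularCurve h₂.v_cont h₂.θ_cont
  obtain ⟨M₃, c₃⟩ := Boussinesq.exists_regularCurve
    (h₁.v_cont.sub (fun _ _ => rfl) h₂.v_cont) (h₁.θ_cont.sub (fun _ _ => rfl) h₂.θ_cont)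
  replace c₁ := c₁.mono (le_max_left M₁ (max M₂ M₃))
  replace c₂ := c₂.mono ((le_max_left M₂ M₃).trans (le_max_right M₁ _))
  replace c₃ := c₃.mono ((le_max_right M₂ M₃).trans (le_max_right M₁ _))
  -- Here q = r - β: q ≥ 1 follows from r > β + 1, and β + 2α + q = 2α + r > 2α + 2β = 5/2 from r >
  -- 2β.
  obtain ⟨C, D, hCD⟩ := Boussinesq.exists_energyRate_bound (α := α) (β := β) hν (by linarith)
    (by linarith) (by linarith) (by linarith) (by linarith) (by linarith) c₁ c₂ c₃
  -- Adding the two lower bounds on r gives r + 2α + q = 2r + 2α - β > 7/2, more than the 3 needed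
  -- for continuity of the fluxes.
  have hmode := Boussinesq.mode_energy_eq_integral (by linarith) (by linarith) (by linarith)
    (by linarith) (by linarith) h₁.weak h₂.weak c₁ c₂
  have hs : ∀ t ∈ Set.Icc 0 T,
      Summable fun k => ‖(v₁ t - v₂ t) k‖ ^ 2 + ‖(θ₁ t - θ₂ t) k‖ ^ 2 := fun t ht =>
    (c₃.summable_v (by linarith) ht).add (c₃.summable_θ (by linarith) ht)
  have hzero := Boussinesq.tsum_eq_zero_of_rate_le hT.le (fun k => (hmode k).2)
    (fun k => (hmode k).1) (fun k t _ => by positivity) hs (fun t ht => (hCD t ht).1)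
    (fun t ht => (hCD t ht).2.1) (fun t ht => (hCD t ht).2.2)
  intro t ht
  have hk : ∀ k, ‖(v₁ t - v₂ t) k‖ ^ 2 + ‖(θ₁ t - θ₂ t) k‖ ^ 2 = 0 := by
    have := (hasSum_zero_iff_of_nonneg fun k => by positivity).1 (hzero t ht ▸ (hs t ht).hasSum)
    exact congrFun this
  have hk' := fun k => (add_eq_zero_iff_of_nonneg (sq_nonneg _) (sq_nonneg _)).1 (hk k)
  exact ⟨funext fun k => sub_eq_zero.1 (norm_eq_zero.1 (pow_eq_zero_iff two_ne_zero |>.1 (hk' k).1)),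
    funext fun k => sub_eq_zero.1 (norm_eq_zero.1 (pow_eq_zero_iff two_ne_zero |>.1 (hk' k).2))⟩
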